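/- **Regret bound for local-HOO.** *Bandit.* Let $\mathcal X$ be a measurable space of arms and let $M$ assign to each $x\in\mathcal X$ a probability distribution $M_x$ on $[0,1]$ such that $f(x)=\int y\,dM_x(y)$ is measurable. Let $f^*=\sup_{\mathcal X} f$ and $\mathcal X_\epsilon=\{x: f(x)\ge f^*-\epsilon\}$. In round $t=1,2,\dots$ an arm $X_t$ is played on the basis of the past (and possibly of randomization), and then a reward $Y_t$ is drawn whose conditional law given the past and $X_t$ is $M_{X_t}$. The regret is $R_n=n f^*-\sum_{t=1}^n f(X_t)$. *Tree.* The parameters of the algorithm are $\nu_1>0$, $\rho\in(0,1)$ and a tree of coverings: measurable sets $\mathcal P_{h,i}\subset\mathcal X$ ($h\ge0$, $1\le i\le 2^h$) with $\mathcal P_{0,1}=\mathcal X$ and $\mathcal P_{h,i}=\mathcal P_{h+1,2i-1}\cup\mathcal P_{h+1,2i}$; the nodes $(h+1,2i-1)$ and $(h+1,2i)$ are the children of $(h,i)$. *$z$-HOO* (for an integer $z\ge0$). Let $(H_t,I_t)$ be the node played in round $t$, and let $\mathcal T_n=\{(0,1)\}\cup\{(H_t,I_t):t\le n\}$. Let $T_{h,i}(n)$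 be the number of rounds $t\le n$ in which $(h,i)$ or one of its descendants was played, and $\hat\mu_{h,i}(n)$ the average of the rewards received in these rounds. Put $U_{h,i}(n)=\hat\mu_{h,i}(n)+\sqrt{2\ln n/T_{h,i}(n)}+\nu_1\rho^h$ if $T_{h,i}(n)>0$ and $U_{h,i}(n)=+\infty$ otherwise; put $B_{h,i}(n)=\min\{U_{h,i}(n),\max\{B_{h+1,2i-1}(n),B_{h+1,2i}(n)\}\}$ if $(h,i)\in\mathcal T_n$ and $B_{h,i}(n)=+\infty$ otherwise. In round $n+1$ the algorithm starts at a node of depth $z$ with the largest value $B(n)$ and, as long as the current node is in $\mathcal T_n$, moves to a child with the larger value $B(n)$; it plays the first node not in $\mathcal T_n$ that it reaches, by choosing an arm in the region of this node. Ties are broken, and arms are chosen in the region, arbitrarily. *Local-HOO.* For $r=1,2,\dots$, regime $r$ consists of the rounds $2^r-1,\dots,2^{r+1}-2$, in which a fresh copy of $z_r$-HOO with $z_r=\lceil\log_2 r\rceil$ is run. *Assumptions.* Let $\ell:\mathcal X^2\to[0,\infty)$ satisfy $\ell(x,x)=0$ for all $x$. Write $\mathcal B(x,\epsilon)=\{y:\ell(x,y)<\epsilon\}$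 and $\operatorname{diam}(A)=\sup_{x,y\in A}\ell(x,y)$, and let $\mathcal N(A,\ell,\epsilon)$ be the largest number of pairwise disjoint balls $\mathcal B(x,\epsilon)$ contained in $A$. Assume that there are constants $\nu_2,\epsilon_0,L,C>0$ and $d\ge0$ such that * (A1) for all $h\ge 0$ and all $i$, $\operatorname{diam}(\mathcal P_{h,i})\le\nu_1\rho^h$, and there are points $x^\circ_{h,i}\in\mathcal P_{h,i}$ with $\mathcal B(x^\circ_{h,i},\nu_2\rho^h)\subset\mathcal P_{h,i}$ such that, for each $h$, these balls are pairwise disjoint; * (A2') $f^*-\inf_A f\le\operatorname{diam}(A)$ for every nonempty $A\subset\mathcal X$ with $\sup_A f=f^*$ and $\operatorname{diam}(A)\le\epsilon_0$; and $\mathcal B\bigl(x,f^*-f(x)+\epsilon\bigr)\subset\mathcal X_{L(2(f^*-f(x))+\epsilon)}$ for all $x\in\mathcal X_{\epsilon_0}$ and $\epsilon\in[0,\epsilon_0]$; * (A3) $\mathcal N(\mathcal X_{c\epsilon},\ell,\epsilon)\le C\epsilon^{-d}$ for all $0<\epsilon\le\epsilon_0$, where $c=4L\nu_1/\nu_2$.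 *Conclusion.* The expected regret of local-HOO is $\mathbb E[R_n]=\tilde O\bigl(n^{(d+1)/(d+2)}\bigr)$ (in a distribution-dependent sense), with one logarithmic factor: there is a constant $K$, which may depend on $M$, on the parameters of the algorithm and on the constants of the assumptions, but not on $n$ or on how ties are broken and arms are chosen, such that for all $n\ge2$ $$\mathbb E[R_n]\le K\,(\ln n)\,n^{(d+1)/(d+2)}.$$ The algorithm uses only $\nu_1$, $\rho$ and the sets $\mathcal P_{h,i}$; in particular it does not use $\epsilon_0$. -/

import Mathlib

open MeasureTheory
open scoped ENNReal

noncomputable section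

namespace LocalHOO

/-! ### Stochastic bandit environments -/

section Environment

variable {𝒳 : Type*}

/-- Mean payoff `f x` of the arm `x`, where `M x` is the reward distribution of `x`. -/
def meanPayoff (M : 𝒳 → Measure ℝ) (x : 𝒳) : ℝ := ∫ y, y ∂(M x)

/-- The best mean payoff `f^* = sup_x f x`. -/
def bestPayoff (M : 𝒳 → Measure ℝ) : ℝ := ⨆ x, meanPayoff M x

/-- `M` is a bandit environment: every `M x` is a probability distribution supported in `[0,1]`,
and the mean-payoff function is measurable. -/
structure IsBanditEnvironment [MeasurableSpace 𝒳] (M : 𝒳 → Measure ℝ) : Prop where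
  isProbabilityMeasure : ∀ x, IsProbabilityMeasure (M x)
  mem_Icc : ∀ x, ∀ᵐ y ∂(M x), y ∈ Set.Icc (0 : ℝ) 1
  measurable_meanPayoff : Measurable (meanPayoff M)

/-- The set `𝒳_ε` of `ε`-optimal arms. -/
def nearOptimal (M : 𝒳 → Measure ℝ) (ε : ℝ) : Set 𝒳 :=
  {x | bestPayoff M - ε ≤ meanPayoff M x}

end Environment

/-! ### Dissimilarities -/

section Dissimilarity

variable {𝒳 : Type*}

/-- A dissimilarity: a nonnegative function of two points, vanishing on the diagonal. -/
structure IsDissimilarity (l : 𝒳 → 𝒳 → ℝ) : Prop where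
  nonneg : ∀ x y, 0 ≤ l x y
  self : ∀ x, l x x = 0

/-- The diameter `sup_{x, y ∈ A} l x y` in `[0, ∞]`. -/
def diam (l : 𝒳 → 𝒳 → ℝ) (A : Set 𝒳) : ℝ≥0∞ :=
  ⨆ x ∈ A, ⨆ y ∈ A, ENNReal.ofReal (l x y)

/-- The open ball with centre `x` and radius `ε`. -/
def ball (l : 𝒳 → 𝒳 → ℝ) (x : 𝒳) (ε : ℝ) : Set 𝒳 := {y | l x y < ε}

/-- The packing number of `A`: the largest number of pairwise disjoint open balls of radius `ε`
contained in `A` (`⊤` if there is no largest number). For a dissimilarity and `ε > 0` balls contain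
their centres, so disjoint balls are counted by their centres. -/
def packingNumber (l : 𝒳 → 𝒳 → ℝ) (A : Set 𝒳) (ε : ℝ) : ℕ∞ :=
  ⨆ (s : Finset 𝒳) (_ : (∀ x ∈ s, ball l x ε ⊆ A) ∧
    (s : Set 𝒳).Pairwise fun x y => Disjoint (ball l x ε) (ball l y ε)), (s.card : ℕ∞)

end Dissimilarity

/-! ### The tree of coverings -/

/-- Nodes of the infinite binary tree: a node at depth `h` is a binary word of length `h`; the root
is `[]`, and the children of `v` are `false :: v` and `true :: v`. Thus the nodes at depth `h` are
the `2 ^ h` words of length `h`, and `w` is a descendant of `v` (every node being a descendant of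
itself) when `v` is a suffix of `w`, which is written `v <:+ w`. -/
abbrev Node : Type := List Bool

/-- A tree of coverings: measurable regions, the region of the root being the whole space and each
region being the union of the regions of the two children. -/
structure IsTreeOfCoverings {𝒳 : Type*} [MeasurableSpace 𝒳] (P : Node → Set 𝒳) : Prop where
  measurableSet : ∀ v, MeasurableSet (P v)
  root : P [] = Set.univ
  children : ∀ v, P v = P (false :: v) ∪ P (true :: v)

/-! ### The assumptions -/

section Assumptions

variable {𝒳 : Type*}

/-- Shrinking regions: diameters decrease geometrically, and the regions contain balls of
geometrically decreasing radii, those of the same depth being pairwise disjoint. -/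
def ShrinkingRegions (ν₁ ρ : ℝ) (P : Node → Set 𝒳) (l : 𝒳 → 𝒳 → ℝ) (ν₂ : ℝ) : Prop :=
  (∀ v : Node, diam l (P v) ≤ ENNReal.ofReal (ν₁ * ρ ^ v.length)) ∧
  ∃ c : Node → 𝒳,
    (∀ v : Node, c v ∈ P v ∧ ball l (c v) (ν₂ * ρ ^ v.length) ⊆ P v) ∧
    ∀ v w : Node, v.length = w.length → v ≠ w →
      Disjoint (ball l (c v) (ν₂ * ρ ^ v.length)) (ball l (c w) (ν₂ * ρ ^ w.length))

/-- The mean-payoff function is `ε₀`-locally `L`-weakly Lipschitz with respect to `l`. -/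
def LocallyWeaklyLipschitz (M : 𝒳 → Measure ℝ) (l : 𝒳 → 𝒳 → ℝ) (ε₀ L : ℝ) : Prop :=
  (∀ A : Set 𝒳, A.Nonempty → sSup (meanPayoff M '' A) = bestPayoff M →
    diam l A ≤ ENNReal.ofReal ε₀ →
    ENNReal.ofReal (bestPayoff M - sInf (meanPayoff M '' A)) ≤ diam l A) ∧
  ∀ x ∈ nearOptimal M ε₀, ∀ ε : ℝ, 0 ≤ ε → ε ≤ ε₀ →
    ball l x (bestPayoff M - meanPayoff M x + ε) ⊆
      nearOptimal M (L * (2 * (bestPayoff M - meanPayoff M x) + ε))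

/-- Packing numbers of the sets of near-optimal arms: at most `C ε ^ (-d)` disjoint balls of
radius `ε` fit into the set of `c ε`-optimal arms, for all `0 < ε ≤ ε₀`. -/
def NearOptimalPacking (M : 𝒳 → Measure ℝ) (l : 𝒳 → 𝒳 → ℝ) (ε₀ c C d : ℝ) : Prop :=
  ∀ ε : ℝ, 0 < ε → ε ≤ ε₀ →
    (packingNumber l (nearOptimal M (c * ε)) ε : ℝ≥0∞) ≤ ENNReal.ofReal (C * ε ^ (-d))

end Assumptions

/-! ### The algorithm `z`-HOO

Below, `H t` and `Y t` are the node played and the reward received by the algorithm in its round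
`t ≥ 1`; all quantities at time `n` depend only on the rounds `1, …, n`. -/

/-- The tree stored at the end of round `n`: the root and the nodes played so far. -/
def tree (H : ℕ → Node) (n : ℕ) : Finset Node :=
  insert [] ((Finset.Icc 1 n).image H)

/-- The rounds among `1, …, n` in which a descendant of `v` was played. -/
def visitRounds (H : ℕ → Node) (n : ℕ) (v : Node) : Finset ℕ :=
  (Finset.Icc 1 n).filter fun t => v <:+ H t

/-- `T_v(n)`: the number of these rounds. -/
def visits (H : ℕ → Node) (n : ℕ) (v : Node) : ℕ := (visitRounds H n v).card

/-- The empirical average of the rewards received in these rounds. -/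
def empMean (H : ℕ → Node) (Y : ℕ → ℝ) (n : ℕ) (v : Node) : ℝ :=
  (∑ t ∈ visitRounds H n v, Y t) / (visits H n v : ℝ)

/-- The `U`-values at the end of round `n`. -/
def uValue (ν₁ ρ : ℝ) (H : ℕ → Node) (Y : ℕ → ℝ) (n : ℕ) (v : Node) : EReal :=
  if visits H n v = 0 then ⊤
  else ((empMean H Y n v + Real.sqrt (2 * Real.log (n : ℝ) / (visits H n v : ℝ))
    + ν₁ * ρ ^ v.length : ℝ) : EReal)

/-- The `B`-values at the end of round `n`. -/
def bValue (ν₁ ρ : ℝ) (H : ℕ → Node) (Y : ℕ → ℝ) (n : ℕ) (v : Node) : EReal :=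
  if v ∈ tree H n then
    min (uValue ν₁ ρ H Y n v)
      (max (bValue ν₁ ρ H Y n (false :: v)) (bValue ν₁ ρ H Y n (true :: v)))
  else ⊤
termination_by (tree H n).sup List.length + 1 - v.length
decreasing_by
  all_goals
    have hv : v.length ≤ (tree H n).sup List.length :=
      Finset.le_sup (f := List.length) (by assumption)
    simp only [List.length_cons]
    omega

/-- The nodes reachable by the traversal started at depth `z`: it starts from a node of depth `z`
with the largest `B`-value and, while the current node belongs to the stored tree `T`, moves to a
child with the largest `B`-value. Ties are broken arbitrarily. -/
inductive Reaches (z : ℕ) (B : Node → EReal) (T : Finset Node) : Node → Prop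
  | start (v : Node) (hz : v.length = z) (hB : ∀ w : Node, w.length = z → B w ≤ B v) :
      Reaches z B T v
  | step (v : Node) (b : Bool) (hv : Reaches z B T v) (hT : v ∈ T)
      (hB : B ((!b) :: v) ≤ B (b :: v)) : Reaches z B T (b :: v)

/-- `z`-HOO may play the node `v` in round `n + 1`, given its first `n` rounds: the traversal based
on the `B`-values at the end of round `n` leaves the stored tree at `v`. -/
def CanPlay (z : ℕ) (ν₁ ρ : ℝ) (H : ℕ → Node) (Y : ℕ → ℝ) (n : ℕ) (v : Node) : Prop :=
  Reaches z (bValue ν₁ ρ H Y n) (tree H n) v ∧ v ∉ tree H n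

/-! ### Local-HOO -/

section LocalHOO

variable {𝒳 Ω : Type*} [MeasurableSpace 𝒳] [MeasurableSpace Ω]

/-- The information available when the reward of round `t` is drawn: the nodes, arms and rewards of
the rounds `1, …, t - 1`, and the node and the arm of round `t`. -/
abbrev past (N : ℕ → Ω → Node) (X : ℕ → Ω → 𝒳) (Y : ℕ → Ω → ℝ) (t : ℕ) : MeasurableSpace Ω :=
  (⨆ s ∈ Finset.Ico 1 t,
    (MeasurableSpace.comap (N s) ⊤ ⊔ MeasurableSpace.comap (X s) inferInstance ⊔
      MeasurableSpace.comap (Y s) inferInstance)) ⊔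
  MeasurableSpace.comap (N t) ⊤ ⊔ MeasurableSpace.comap (X t) inferInstance

/-- `N t`, `X t`, `Y t` (for the rounds `t ≥ 1`) are the nodes played, the arms played and the
rewards received when local-HOO, run with the parameters `ν₁`, `ρ`, `P`, interacts with the
environment `M`.
Regime `r ≥ 1` consists of the `2 ^ r` rounds `2 ^ r - 1, …, 2 ^ (r + 1) - 2`; it runs a fresh copy
of `z_r`-HOO with `z_r = ⌈log₂ r⌉`, whose round `s` is the round `2 ^ r - 2 + s`.
Ties are broken, and arms are chosen in the region of the selected node, in an arbitrary (possibly
random and history-dependent) way. -/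
structure IsLocalHOORun (M : 𝒳 → Measure ℝ) (ν₁ ρ : ℝ) (P : Node → Set 𝒳) (μ : Measure Ω)
    (N : ℕ → Ω → Node) (X : ℕ → Ω → 𝒳) (Y : ℕ → Ω → ℝ) : Prop where
  measurable_node : ∀ t v, MeasurableSet {ω | N t ω = v}
  measurable_arm : ∀ t, Measurable (X t)
  measurable_reward : ∀ t, Measurable (Y t)
  /-- The node of round `m + 1` of regime `r` is selected by `z_r`-HOO from the `m` previous rounds
  of this regime. -/
  node_selected : ∀ r : ℕ, 1 ≤ r → ∀ m : ℕ, m < 2 ^ r → ∀ᵐ ω ∂μ,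
    CanPlay (Nat.clog 2 r) ν₁ ρ (fun s => N (2 ^ r - 2 + s) ω) (fun s => Y (2 ^ r - 2 + s) ω) m
      (N (2 ^ r - 2 + (m + 1)) ω)
  /-- The arm is chosen in the region of the selected node. -/
  arm_mem : ∀ t : ℕ, 1 ≤ t → ∀ᵐ ω ∂μ, X t ω ∈ P (N t ω)
  /-- Given the past, the selected node and the selected arm, the reward has law `M (X t)`. -/
  reward_law : ∀ t : ℕ, 1 ≤ t → ∀ g : ℝ → ℝ, Measurable g → (∃ c : ℝ, ∀ y, |g y| ≤ c) →
    μ[fun ω => g (Y t ω) | past N X Y t] =ᵐ[μ] fun ω => ∫ y, g y ∂(M (X t ω))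

/-- The pseudo-regret `R_n = n f^* - ∑_{t ≤ n} f (X_t)`. -/
def pseudoRegret (M : 𝒳 → Measure ℝ) (X : ℕ → Ω → 𝒳) (n : ℕ) (ω : Ω) : ℝ :=
  (n : ℝ) * bestPayoff M - ∑ t ∈ Finset.Icc 1 n, meanPayoff M (X t ω)

end LocalHOO

end LocalHOO

end

/-! Call a node of depth `h` promising if its region holds an arm better than `2ν₁ρ^h`-optimal. By
the weak Lipschitz condition the whole region is then `4Lν₁ρ^h`-optimal (`IsPromising.regret_le`),
so the disjoint balls inside such regions form a packing, and depth `h` has at most a constant times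
`ρ^(-dh)` promising nodes (`card_promising_le`). Unpromising nodes are visited rarely. Along a path
of regions with supremum `f^*`, all U-values stay above `f^*` unless rewards deviate, and hence so
does the U-value of every stored node traversed; but an unpromising node falls below `f^*` after
about `8 ln m / (ν₁ρ^h)²` visits (`sum_ind_visits_le`). Deviations cost a bounded expected number of
rounds, by a Chernoff bound and a union over the number of visits
(`measureReal_sum_indicator_gt_le`).

These arguments need regions small compared with `ε₀`. Since the starting depth `z_r` tends to
infinity, they apply to all but finitely many regimes, and those cost a constant. The price is that
nodes of depth `z_r` may be far from optimal; but there are at most `2r` of them, so their cost is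
polynomial in `r`.

In a regime of length `m = 2^r`, each round without deviation is charged to an unpromising node of
depth `z`, to an unpromising child of a promising node of depth `h < k`, to a promising node played
itself (once only), or to a promising node at the cut-off depth `k` (`node_cases`, `run_regret_le`).
The intermediate levels cost a multiple of `r ∑ ρ^(-(d+1)h)` and the cut-off a multiple of `m ρ^k`.
Both balance at `ρ^k ≈ m^(-1/(d+2))`, giving `O(r · 2^(r(d+1)/(d+2)))` per regime. The sum over `r ≤
log₂ (n+1)` is geometric up to the factor `r`, whence a single logarithm. -/

noncomputable section

namespace LocalHOO

/-! ### The traversal -/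

section Traversal

variable {z : ℕ} {B : Node → EReal} {T : Finset Node} {v w : Node}

lemma Reaches.le_length (h : Reaches z B T v) : z ≤ v.length := by
  induction h with
  | start v hz hB => exact hz.ge
  | step v b hv hT hB ih => simp only [List.length_cons]; omega

lemma Reaches.length_le {D : ℕ} (hz : z ≤ D + 1) (hD : ∀ u ∈ T, u.length ≤ D)
    (h : Reaches z B T v) : v.length ≤ D + 1 := by
  induction h with
  | start v hz' hB => omega
  | step v b hv hT hB ih => simpa using hD v hT

/-- Ancestors are suffixes, so the traversal passes through every ancestor of its endpoint that is
not above the starting depth, and only the endpoint can lie outside the tree. -/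
lemma Reaches.suffix (h : Reaches z B T v) (hw : w <:+ v) (hz : z ≤ w.length) :
    Reaches z B T w ∧ (w ≠ v → w ∈ T) := by
  induction h with
  | start v hz' hB =>
    have : w = v := hw.eq_of_length (le_antisymm hw.length_le (hz'.le.trans hz))
    subst this
    exact ⟨.start w hz' hB, fun h => (h rfl).elim⟩
  | step v b hv hT hB ih =>
    rcases List.suffix_cons_iff.1 hw with rfl | hw'
    · exact ⟨.step v b hv hT hB, fun h => (h rfl).elim⟩
    · refine ⟨(ih hw').1, fun _ => ?_⟩
      by_cases hwv : w = v
      · exact hwv ▸ hT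
      · exact (ih hw').2 hwv

/-- B-values cannot decrease along the traversal: a stored node is bounded by its better child,
which is the one chosen. -/
lemma Reaches.le_value {a : EReal} (hs : ∃ w : Node, w.length = z ∧ a ≤ B w)
    (hB : ∀ v ∈ T, B v ≤ max (B (false :: v)) (B (true :: v))) (h : Reaches z B T v) :
    a ≤ B v := by
  induction h with
  | start v hz hB' =>
    obtain ⟨w, hw, haw⟩ := hs
    exact haw.trans (hB' w hw)
  | step v b hv hT hB' ih =>
    refine (ih.trans (hB v hT)).trans (max_le ?_ ?_) <;> cases b <;> first | exact le_rfl | exact hB'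

end Traversal

/-! ### Upper confidence bounds -/

section Values

variable {ν₁ ρ : ℝ} {H : ℕ → Node} {Y F : ℕ → ℝ} {n : ℕ} {v : Node} {z : ℕ}

lemma bValue_of_notMem (h : v ∉ tree H n) : bValue ν₁ ρ H Y n v = ⊤ := by
  rw [bValue, if_neg h]

lemma bValue_of_mem (h : v ∈ tree H n) : bValue ν₁ ρ H Y n v = min (uValue ν₁ ρ H Y n v)
    (max (bValue ν₁ ρ H Y n (false :: v)) (bValue ν₁ ρ H Y n (true :: v))) := by
  rw [bValue, if_pos h]

/-- Backward induction along the path, from beyond the deepest stored level, where B-values are `⊤`.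
-/
lemma le_bValue_of_path {a : EReal} {o : ℕ → Node}
    (hlen : ∀ h, (o h).length = h) (hchild : ∀ h, ∃ b, o (h + 1) = b :: o h)
    (hU : ∀ h, z ≤ h → a ≤ uValue ν₁ ρ H Y n (o h)) {h : ℕ} (hz : z ≤ h) :
    a ≤ bValue ν₁ ρ H Y n (o h) := by
  suffices ∀ k h, z ≤ h → (tree H n).sup List.length + 1 ≤ h + k →
      a ≤ bValue ν₁ ρ H Y n (o h) from
    this ((tree H n).sup List.length + 1) h hz (by omega)
  intro k
  induction k with
  | zero =>
    intro h _ hk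
    rw [bValue_of_notMem]
    · exact le_top
    · intro hmem
      have := Finset.le_sup (f := List.length) hmem
      rw [hlen] at this
      omega
  | succ k ih =>
    intro h hz hk
    by_cases hmem : o h ∈ tree H n
    · rw [bValue_of_mem hmem]
      refine le_min (hU h hz) ?_
      have := ih (h + 1) (by omega) (by omega)
      obtain ⟨b, hb⟩ := hchild h
      rw [hb] at this
      cases b
      · exact this.trans (le_max_left _ _)
      · exact this.trans (le_max_right _ _)
    · rw [bValue_of_notMem hmem]
      exact le_top

/-- The sum of the `Y t` over the visits of `v` exceeds that of the `F t` by more than the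
confidence width. -/
def Deviates (H : ℕ → Node) (Y F : ℕ → ℝ) (n : ℕ) (v : Node) : Prop :=
  Real.sqrt (2 * Real.log (n : ℝ) * (visits H n v : ℝ)) < ∑ t ∈ visitRounds H n v, (Y t - F t)

lemma not_deviates_of_visits_eq_zero (h : visits H n v = 0) : ¬ Deviates H Y F n v := by
  rw [visits, Finset.card_eq_zero] at h
  simp [Deviates, visits, h]

lemma sqrt_div_visits (a T : ℝ) (hT : 0 < T) : Real.sqrt (a / T) = Real.sqrt (a * T) / T := by
  have : a / T = a * T / T ^ 2 := by field_simp
  rw [this, Real.sqrt_div' _ (by positivity), Real.sqrt_sq hT.le]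

lemma le_uValue {a : ℝ} (hF : ∀ t ∈ visitRounds H n v, a - ν₁ * ρ ^ v.length ≤ F t)
    (hdev : ¬ Deviates H F Y n v) : (a : EReal) ≤ uValue ν₁ ρ H Y n v := by
  rw [uValue]
  split_ifs with h
  · exact le_top
  have hT : (0 : ℝ) < visits H n v := by exact_mod_cast Nat.pos_of_ne_zero h
  rw [Deviates, not_lt, Finset.sum_sub_distrib] at hdev
  have hsum := Finset.card_nsmul_le_sum _ _ _ hF
  rw [nsmul_eq_mul] at hsum
  change (visits H n v : ℝ) * _ ≤ _ at hsum
  rw [EReal.coe_le_coe_iff, sqrt_div_visits _ _ hT, empMean, ← add_div]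
  have : a - ν₁ * ρ ^ v.length ≤ (∑ t ∈ visitRounds H n v, Y t +
      Real.sqrt (2 * Real.log n * visits H n v)) / visits H n v := by
    rw [le_div_iff₀ hT]
    linarith
  linarith

/-- With `D = ν₁ρ^h`, `T` visits and confidence width `S = √(2 T ln n)` for the sum, the rewards
total at most `T(a - 2D) + S`, while `U ≥ a` forces at least `T(a - D) - S`. Hence `DT ≤ 2S`, and
squaring gives the bound. -/
lemma visits_le_of_le_uValue {a : ℝ} (hν : 0 < ν₁ * ρ ^ v.length)
    (hF : ∀ t ∈ visitRounds H n v, F t ≤ a - 2 * (ν₁ * ρ ^ v.length))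
    (hdev : ¬ Deviates H Y F n v) (hU : (a : EReal) ≤ uValue ν₁ ρ H Y n v) :
    (visits H n v : ℝ) ≤ 8 * Real.log n / (ν₁ * ρ ^ v.length) ^ 2 := by
  have hlog : 0 ≤ Real.log (n : ℝ) := Real.log_natCast_nonneg n
  rw [uValue] at hU
  split_ifs at hU with h
  · rw [h, Nat.cast_zero]
    positivity
  have hT : (0 : ℝ) < visits H n v := by exact_mod_cast Nat.pos_of_ne_zero h
  rw [Deviates, not_lt, Finset.sum_sub_distrib] at hdev
  have hsum := Finset.sum_le_card_nsmul _ _ _ hF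
  rw [nsmul_eq_mul] at hsum
  change _ ≤ (visits H n v : ℝ) * _ at hsum
  rw [EReal.coe_le_coe_iff, sqrt_div_visits _ _ hT, empMean, ← add_div] at hU
  set D := ν₁ * ρ ^ v.length
  set T : ℝ := ((visits H n v : ℕ) : ℝ)
  set S := Real.sqrt (2 * Real.log n * T)
  have h1 : (a - D) * T ≤ ∑ t ∈ visitRounds H n v, Y t + S := by
    rw [← le_div_iff₀ hT]
    linarith
  have h2 : D * T ≤ 2 * S := by linarith
  have h3 : S ^ 2 = 2 * Real.log n * T := Real.sq_sqrt (by positivity)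
  have h4 : (D * T) ^ 2 ≤ (2 * S) ^ 2 := pow_le_pow_left₀ (by positivity) h2 2
  rw [le_div_iff₀ (by positivity)]
  have h5 : (T * D ^ 2) * T ≤ (8 * Real.log n) * T := by nlinarith
  exact le_of_mul_le_mul_right h5 hT

end Values

/-! ### Rounds of a run -/

section Rounds

variable {ν₁ ρ : ℝ} {H : ℕ → Node} {Y F : ℕ → ℝ} {m n z : ℕ} {v w : Node}

lemma mem_visitRounds {t : ℕ} : t ∈ visitRounds H n v ↔ (1 ≤ t ∧ t ≤ n) ∧ v <:+ H t := by
  simp [visitRounds]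

lemma injOn_of_canPlay (hplay : ∀ n < m, CanPlay z ν₁ ρ H Y n (H (n + 1))) :
    Set.InjOn H (Finset.Icc 1 m) := by
  have key : ∀ s t, 1 ≤ s → s < t → t ≤ m → H s ≠ H t := by
    intro s t hs hst ht heq
    obtain ⟨n, rfl⟩ : ∃ n, t = n + 1 := ⟨t - 1, by omega⟩
    refine (hplay n (by omega)).2 ?_
    rw [← heq, tree]
    exact Finset.mem_insert_of_mem (Finset.mem_image_of_mem _ (by simp; omega))
  intro s hs t ht heq
  simp only [Finset.coe_Icc, Set.mem_Icc] at hs ht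
  rcases lt_trichotomy s t with h | h | h
  · exact (key s t hs.1 h ht.2 heq).elim
  · exact h
  · exact (key t s ht.1 h hs.2 heq.symm).elim

lemma length_le_of_canPlay (hplay : ∀ n < m, CanPlay z ν₁ ρ H Y n (H (n + 1))) :
    ∀ t, 1 ≤ t → t ≤ m → (H t).length ≤ z + t := by
  intro t
  induction t using Nat.strong_induction_on with
  | _ t ih =>
    intro h1 htm
    obtain ⟨n, rfl⟩ : ∃ n, t = n + 1 := ⟨t - 1, by omega⟩
    refine (hplay n (by omega)).1.length_le (D := z + n) (by omega) ?_
    intro u hu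
    rw [tree, Finset.mem_insert, Finset.mem_image] at hu
    rcases hu with rfl | ⟨s, hs, rfl⟩
    · simp
    · rw [Finset.mem_Icc] at hs
      have := ih s (by omega) hs.1 (by omega)
      omega

/-- While the upper confidence bounds along an optimal path are at least `a`, so are those of the
stored nodes through which the traversal goes. -/
lemma le_uValue_of_canPlay {a : EReal} {o : ℕ → Node}
    (hlen : ∀ h, (o h).length = h) (hchild : ∀ h, ∃ b, o (h + 1) = b :: o h)
    (hU : ∀ h, z ≤ h → a ≤ uValue ν₁ ρ H Y n (o h)) (hplay : CanPlay z ν₁ ρ H Y n w)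
    (hv : v <:+ w) (hvw : v ≠ w) (hz : z ≤ v.length) : a ≤ uValue ν₁ ρ H Y n v := by
  obtain ⟨hreach, hmem⟩ := hplay.1.suffix hv hz
  have hB := hreach.le_value (a := a)
    ⟨o z, hlen z, le_bValue_of_path hlen hchild hU le_rfl⟩
    (fun v hv => by rw [bValue_of_mem hv]; exact min_le_right _ _)
  rw [bValue_of_mem (hmem hvw)] at hB
  exact hB.trans (min_le_left _ _)

/-- A finite set of visits of a node `v`, such that before each of them that does not play `v` itself
the number of visits was at most `u`, has at most `u + 2` elements. -/
lemma card_le_of_visits_le (hplay : ∀ n < m, CanPlay z ν₁ ρ H Y n (H (n + 1))) {u : ℝ} (hu : 0 ≤ u)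
    {S : Finset ℕ} (hS : ∀ n ∈ S, n < m ∧ v <:+ H (n + 1))
    (hSu : ∀ n ∈ S, v ≠ H (n + 1) → (visits H n v : ℝ) ≤ u) : (S.card : ℝ) ≤ u + 2 := by
  classical
  -- When `v` itself is played it is not yet stored, so its U-value has not been tested; this
  -- happens at most once.
  have h1 : (S.filter fun n => v = H (n + 1)).card ≤ 1 := by
    rw [Finset.card_le_one]
    intro a ha b hb
    rw [Finset.mem_filter] at ha hb
    have := injOn_of_canPlay hplay (x₁ := a + 1) (x₂ := b + 1)
      (by simpa using (hS a ha.1).1) (by simpa using (hS b hb.1).1)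
      (ha.2.symm.trans hb.2)
    omega
  have h2 : ((S.filter fun n => v ≠ H (n + 1)).card : ℝ) ≤ u + 1 := by
    set S' := S.filter fun n => v ≠ H (n + 1) with hS'
    rcases S'.eq_empty_or_nonempty with h | h
    · rw [h]; simp; linarith
    · have hmax := S'.max'_mem h
      have hvis := hSu _ (Finset.mem_filter.1 hmax).1 (Finset.mem_filter.1 hmax).2
      -- Apart from the last element of `S'`, each element `n` gives a visit in round `n + 1`, which
      -- is already counted at the last element.
      have hsub : S' ⊆ insert (S'.max' h) ((visitRounds H (S'.max' h) v).image (· - 1)) := by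
        intro n hn
        rcases (S'.le_max' n hn).lt_or_eq with hlt | heq
        · refine Finset.mem_insert_of_mem (Finset.mem_image.2 ⟨n + 1, ?_, by simp⟩)
          rw [mem_visitRounds]
          exact ⟨⟨by omega, hlt⟩, (hS n (Finset.mem_filter.1 hn).1).2⟩
        · rw [← heq]; exact Finset.mem_insert_self _ _
      have hc := (Finset.card_le_card hsub).trans ((Finset.card_insert_le _ _).trans
        (Nat.add_le_add_right Finset.card_image_le 1))
      have : (S'.card : ℝ) ≤ visits H (S'.max' h) v + 1 := by exact_mod_cast hc
      linarith
  have h3 := Finset.card_filter_add_card_filter_not (s := S) (fun n => v = H (n + 1))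
  have h4 : (S.card : ℝ) = (S.filter fun n => v = H (n + 1)).card +
      (S.filter fun n => v ≠ H (n + 1)).card := by exact_mod_cast h3.symm
  have h5 : ((S.filter fun n => v = H (n + 1)).card : ℝ) ≤ 1 := by exact_mod_cast h1
  linarith

end Rounds

/-! ### Concentration of sums over predictably chosen rounds -/

section Concentration

variable {Ω : Type*} {m0 : MeasurableSpace Ω} {μ : Measure Ω} [IsProbabilityMeasure μ]
  {𝓕 : ℕ → MeasurableSpace Ω} {A : ℕ → Set Ω} {ξ : ℕ → Ω → ℝ}

/-- The exponential process of the selected increments. -/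
def expProcess (A : ℕ → Set Ω) (ξ : ℕ → Ω → ℝ) (s : ℝ) (n : ℕ) (ω : Ω) : ℝ :=
  Real.exp (∑ t ∈ Finset.Icc 1 n, (A t).indicator (fun ω => s * ξ t ω - s ^ 2 / 8) ω)

lemma expProcess_pos (s : ℝ) (n : ℕ) (ω : Ω) : 0 < expProcess A ξ s n ω := Real.exp_pos _

/-- The additive form keeps the new increment in a single product whose other factor is known before
the round, ready for conditioning; off `A (n + 1)` the last two terms vanish. -/
lemma expProcess_succ (s : ℝ) (n : ℕ) (ω : Ω) :
    expProcess A ξ s (n + 1) ω = expProcess A ξ s n ω +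
      (A (n + 1)).indicator (expProcess A ξ s n) ω * Real.exp (- (s ^ 2 / 8)) *
        Real.exp (s * ξ (n + 1) ω) - (A (n + 1)).indicator (expProcess A ξ s n) ω := by
  rw [expProcess, Finset.sum_Icc_succ_top (by omega), Real.exp_add]
  by_cases h : ω ∈ A (n + 1)
  · simp only [Set.indicator_of_mem h]
    rw [sub_eq_add_neg, Real.exp_add]
    simp only [expProcess]
    ring
  · simp [Set.indicator_of_notMem h, expProcess]

lemma measurable_expProcess (hmono : ∀ i j, 1 ≤ i → i ≤ j → 𝓕 i ≤ 𝓕 j)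
    (hA : ∀ t, 1 ≤ t → MeasurableSet[𝓕 t] (A t)) (hξ : ∀ t, 1 ≤ t → Measurable[𝓕 (t + 1)] (ξ t))
    (s : ℝ) (n : ℕ) : Measurable[𝓕 (n + 1)] (expProcess A ξ s n) := by
  refine Real.measurable_exp.comp (Finset.measurable_fun_sum _ fun t ht => ?_)
  rw [Finset.mem_Icc] at ht
  exact ((((hξ t ht.1).mono (hmono _ _ (by omega) (by omega)) le_rfl).const_mul s).sub_const
    _).indicator (hmono t _ ht.1 (by omega) _ (hA t ht.1))

lemma expProcess_le (hb : ∀ t ω, |ξ t ω| ≤ 1) (s : ℝ) (n : ℕ) (ω : Ω) :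
    expProcess A ξ s n ω ≤ Real.exp (n * |s|) := by
  refine Real.exp_le_exp.2 ((Finset.sum_le_card_nsmul _ _ |s| fun t _ => ?_).trans (by simp))
  refine Set.indicator_apply_le' (fun _ => ?_) fun _ => abs_nonneg s
  have h1 : s * ξ t ω ≤ |s| := (le_abs_self _).trans (by
    rw [abs_mul]; exact mul_le_of_le_one_right (abs_nonneg s) (hb t ω))
  nlinarith [sq_nonneg s]

/-- The process is a supermartingale: the selection and the earlier increments factor out of the
conditional expectation, and the compensator `s ^ 2 / 8` cancels the bound on the moment generating
function. -/
lemma integral_expProcess_le_one (hle : ∀ t, 1 ≤ t → 𝓕 t ≤ m0)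
    (hmono : ∀ i j, 1 ≤ i → i ≤ j → 𝓕 i ≤ 𝓕 j)
    (hA : ∀ t, 1 ≤ t → MeasurableSet[𝓕 t] (A t)) (hξ : ∀ t, 1 ≤ t → Measurable[𝓕 (t + 1)] (ξ t))
    (hb : ∀ t ω, |ξ t ω| ≤ 1) (s : ℝ)
    (hmgf : ∀ t, 1 ≤ t →
      μ[fun ω => Real.exp (s * ξ t ω) | 𝓕 t] ≤ᵐ[μ] fun _ => Real.exp (s ^ 2 / 8)) (n : ℕ) :
    Integrable (expProcess A ξ s n) μ ∧ ∫ ω, expProcess A ξ s n ω ∂μ ≤ 1 := by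
  have hint : ∀ n, Integrable (expProcess A ξ s n) μ := fun n =>
    Integrable.of_bound ((measurable_expProcess hmono hA hξ s n).mono
      (hle _ (by omega)) le_rfl).aestronglyMeasurable (Real.exp (n * |s|))
      (.of_forall fun ω => by
        rw [Real.norm_eq_abs, abs_of_pos (expProcess_pos s n ω)]; exact expProcess_le hb s n ω)
  refine ⟨hint n, ?_⟩
  induction n with
  | zero => simp [expProcess]
  | succ n ih =>
    set W : Ω → ℝ := fun ω => (A (n + 1)).indicator (expProcess A ξ s n) ω *
      Real.exp (- (s ^ 2 / 8)) with hW
    have hWm : Measurable[𝓕 (n + 1)] W :=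
      ((measurable_expProcess hmono hA hξ s n).indicator (hA _ (by omega))).mul_const _
    have hW0 : ∀ ω, 0 ≤ W ω := fun ω =>
      mul_nonneg (Set.indicator_nonneg (fun _ _ => (Real.exp_pos _).le) _) (Real.exp_pos _).le
    have hAm : MeasurableSet (A (n + 1)) := hle _ (by omega) _ (hA _ (by omega))
    have hIint := (hint n).indicator hAm
    have hWint : Integrable W μ := hIint.mul_const _
    have hem : Measurable fun ω => Real.exp (s * ξ (n + 1) ω) :=
      Real.measurable_exp.comp
        (((hξ (n + 1) (by omega)).mono (hle _ (by omega)) le_rfl).const_mul s)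
    have hebd : ∀ᵐ ω ∂μ, ‖Real.exp (s * ξ (n + 1) ω)‖ ≤ Real.exp |s| := .of_forall fun ω => by
      rw [Real.norm_eq_abs, abs_of_pos (Real.exp_pos _)]
      refine Real.exp_le_exp.2 ((le_abs_self _).trans ?_)
      rw [abs_mul]
      exact mul_le_of_le_one_right (abs_nonneg s) (hb _ ω)
    have heint : Integrable (fun ω => Real.exp (s * ξ (n + 1) ω)) μ :=
      .of_bound hem.aestronglyMeasurable _ hebd
    have hWe : Integrable (W * fun ω => Real.exp (s * ξ (n + 1) ω)) μ :=
      hWint.mul_bdd (c := Real.exp |s|) hem.aestronglyMeasurable hebd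
    have key : ∫ ω, W ω * Real.exp (s * ξ (n + 1) ω) ∂μ ≤
        ∫ ω, (A (n + 1)).indicator (expProcess A ξ s n) ω ∂μ := by
      have h1 := integral_condExp (μ := μ) (hle (n + 1) (by omega))
        (f := W * fun ω => Real.exp (s * ξ (n + 1) ω))
      have h2 := condExp_mul_of_stronglyMeasurable_left (μ := μ) hWm.stronglyMeasurable hWe heint
      change _ = ∫ ω, W ω * Real.exp (s * ξ (n + 1) ω) ∂μ at h1
      rw [← h1]
      refine integral_mono_ae integrable_condExp hIint ?_
      filter_upwards [h2, hmgf (n + 1) (by omega)] with ω h2 h3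
      rw [h2, Pi.mul_apply]
      refine (mul_le_mul_of_nonneg_left h3 (hW0 ω)).trans ?_
      rw [hW]
      simp only
      rw [mul_assoc, ← Real.exp_add]
      simp
    have hsplit : ∫ ω, expProcess A ξ s (n + 1) ω ∂μ = ∫ ω, expProcess A ξ s n ω ∂μ +
        ∫ ω, W ω * Real.exp (s * ξ (n + 1) ω) ∂μ -
        ∫ ω, (A (n + 1)).indicator (expProcess A ξ s n) ω ∂μ := by
      have h1 := integral_add (hint n) hWe
      have h2 := integral_sub ((hint n).add hWe) hIint
      simp only [Pi.add_apply, Pi.mul_apply] at h1 h2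
      rw [← h1, ← h2]
      exact integral_congr_ae (.of_forall fun ω => expProcess_succ s n ω)
    linarith

/-- The number of selected rounds among the first `n`. -/
def selCount (A : ℕ → Set Ω) (n : ℕ) (ω : Ω) : ℝ :=
  ∑ t ∈ Finset.Icc 1 n, (A t).indicator (fun _ => (1 : ℝ)) ω

/-- The sum of the selected increments is unlikely to exceed its confidence width. -/
theorem measureReal_sum_indicator_gt_le (hle : ∀ t, 1 ≤ t → 𝓕 t ≤ m0)
    (hmono : ∀ i j, 1 ≤ i → i ≤ j → 𝓕 i ≤ 𝓕 j)
    (hA : ∀ t, 1 ≤ t → MeasurableSet[𝓕 t] (A t)) (hξ : ∀ t, 1 ≤ t → Measurable[𝓕 (t + 1)] (ξ t))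
    (hb : ∀ t ω, |ξ t ω| ≤ 1)
    (hmgf : ∀ s : ℝ, ∀ t, 1 ≤ t →
      μ[fun ω => Real.exp (s * ξ t ω) | 𝓕 t] ≤ᵐ[μ] fun _ => Real.exp (s ^ 2 / 8)) (n : ℕ) :
    μ.real {ω | Real.sqrt (2 * Real.log n * selCount A n ω) <
      ∑ t ∈ Finset.Icc 1 n, (A t).indicator (ξ t) ω} ≤ ((n : ℝ) ^ 3)⁻¹ := by
  classical
  rcases Nat.eq_zero_or_pos n with rfl | hn
  · simp [selCount]
  have hn' : (1 : ℝ) ≤ n := by exact_mod_cast hn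
  have hn0 : (0 : ℝ) < n := by linarith
  set a : ℕ → ℝ := fun k => Real.sqrt (2 * Real.log n * k)
  -- This is the maximiser of `λ a - λ² k / 8`; the maximum `2 a² / k` equals `4 ln n`.
  set lam : ℕ → ℝ := fun k => 4 * a k / k
  -- The number of selected rounds is random, so each of its values gets its own exponent. The value
  -- `0` is excluded by the strict inequality.
  have hsub : {ω | Real.sqrt (2 * Real.log n * selCount A n ω) <
      ∑ t ∈ Finset.Icc 1 n, (A t).indicator (ξ t) ω} ⊆
      ⋃ k ∈ Finset.Icc 1 n, {ω | (n : ℝ) ^ 4 ≤ expProcess A ξ (lam k) n ω} := by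
    intro ω hω
    rw [Set.mem_ofPred_eq] at hω
    set k := ((Finset.Icc 1 n).filter fun t => ω ∈ A t).card
    have hk : selCount A n ω = k := by
      simp [selCount, Set.indicator_apply, k]
    have hk1 : 1 ≤ k := by
      rw [Nat.one_le_iff_ne_zero]
      intro hk0
      rw [Finset.card_eq_zero, Finset.filter_eq_empty_iff] at hk0
      rw [Finset.sum_eq_zero fun t ht => Set.indicator_of_notMem (hk0 ht) _] at hω
      exact absurd hω (not_lt.2 (Real.sqrt_nonneg _))
    have hkn : k ≤ n := (Finset.card_filter_le _ _).trans (by simp)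
    rw [hk] at hω
    simp only [Set.mem_iUnion]
    refine ⟨k, Finset.mem_Icc.2 ⟨hk1, hkn⟩, ?_⟩
    rw [Set.mem_ofPred_eq, expProcess, ← Real.exp_log (pow_pos hn0 4), Real.exp_le_exp,
      Real.log_pow]
    have hsum : ∑ t ∈ Finset.Icc 1 n,
        (A t).indicator (fun ω => lam k * ξ t ω - lam k ^ 2 / 8) ω =
        lam k * ∑ t ∈ Finset.Icc 1 n, (A t).indicator (ξ t) ω - lam k ^ 2 / 8 * k := by
      rw [← hk, selCount, Finset.mul_sum, Finset.mul_sum, ← Finset.sum_sub_distrib]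
      refine Finset.sum_congr rfl fun t _ => ?_
      by_cases h : ω ∈ A t <;> simp [h]
    have hk0 : (0 : ℝ) < k := by exact_mod_cast hk1
    have ha : a k ^ 2 = 2 * Real.log n * k :=
      Real.sq_sqrt (by have := Real.log_nonneg hn'; positivity)
    have hlam : 0 ≤ lam k := by positivity
    rw [hsum]
    have h1 : lam k * a k - lam k ^ 2 / 8 * k = 4 * Real.log n := by
      have : lam k * a k - lam k ^ 2 / 8 * k = 2 * a k ^ 2 / k := by
        simp only [lam]; field_simp; ring
      rw [this, ha]; field_simp; ring
    have h2 := mul_le_mul_of_nonneg_left hω.le hlam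
    push_cast
    linarith
  refine (measureReal_mono hsub (measure_ne_top _ _)).trans
    ((measureReal_biUnion_finset_le _ _).trans ?_)
  have hone : ∀ k ∈ Finset.Icc 1 n,
      μ.real {ω | (n : ℝ) ^ 4 ≤ expProcess A ξ (lam k) n ω} ≤ ((n : ℝ) ^ 4)⁻¹ := by
    intro k _
    obtain ⟨hi, h1⟩ := integral_expProcess_le_one (μ := μ) hle hmono hA hξ hb (lam k)
      (hmgf (lam k)) n
    have := mul_meas_ge_le_integral_of_nonneg (f := expProcess A ξ (lam k) n)
      (.of_forall fun ω => (expProcess_pos _ _ _).le) hi ((n : ℝ) ^ 4)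
    rw [← one_div, le_div_iff₀ (by positivity)]
    linarith
  -- The union over `n` counts turns `n ^ (-4)` into `n ^ (-3)`.
  refine (Finset.sum_le_card_nsmul _ _ _ hone).trans (le_of_eq ?_)
  simp
  field_simp

end Concentration

/-! ### Rewards -/

section Rewards

variable {𝒳 : Type*} [MeasurableSpace 𝒳] {M : 𝒳 → Measure ℝ}

lemma IsBanditEnvironment.meanPayoff_mem (hM : IsBanditEnvironment M) (x : 𝒳) :
    meanPayoff M x ∈ Set.Icc (0 : ℝ) 1 := by
  have := hM.isProbabilityMeasure x
  have hint : Integrable (fun y : ℝ => y) (M x) :=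
    .of_mem_Icc 0 1 aemeasurable_id (hM.mem_Icc x)
  constructor
  · exact integral_nonneg_of_ae ((hM.mem_Icc x).mono fun y hy => hy.1)
  · refine (integral_mono_ae hint (integrable_const 1) ((hM.mem_Icc x).mono fun y hy => hy.2)).trans
      ?_
    simp

/-- Truncation to the unit interval. -/
def clip (y : ℝ) : ℝ := max 0 (min 1 y)

lemma measurable_clip : Measurable clip := by unfold clip; fun_prop

lemma clip_mem (y : ℝ) : clip y ∈ Set.Icc (0 : ℝ) 1 :=
  ⟨le_max_left _ _, max_le zero_le_one (min_le_left _ _)⟩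

lemma clip_of_mem {y : ℝ} (hy : y ∈ Set.Icc (0 : ℝ) 1) : clip y = y := by
  simp [clip, hy.1, hy.2]

/-- Hoeffding's lemma for the reward distributions. -/
lemma IsBanditEnvironment.integral_exp_clip_le (hM : IsBanditEnvironment M) (x : 𝒳) (s : ℝ) :
    Real.exp (-(s * meanPayoff M x)) * ∫ y, Real.exp (s * clip y) ∂(M x) ≤
      Real.exp (s ^ 2 / 8) := by
  have := hM.isProbabilityMeasure x
  have h := (ProbabilityTheory.hasSubgaussianMGF_of_mem_Icc (μ := M x) (X := fun y : ℝ => y)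
    aemeasurable_id (hM.mem_Icc x)).mgf_le s
  rw [ProbabilityTheory.mgf] at h
  refine le_trans (le_of_eq ?_) (h.trans (le_of_eq ?_))
  · rw [← integral_const_mul]
    refine integral_congr_ae ((hM.mem_Icc x).mono fun y hy => ?_)
    simp only
    rw [clip_of_mem hy, ← Real.exp_add, meanPayoff]
    ring_nf
  · congr 1
    simp
    ring

variable {Ω : Type*} {N : ℕ → Ω → Node} {X : ℕ → Ω → 𝒳} {Y : ℕ → Ω → ℝ}

lemma comap_le_of_forall_eq {m : MeasurableSpace Ω} {g : Ω → Node}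
    (h : ∀ v, MeasurableSet[m] {ω | g ω = v}) : MeasurableSpace.comap g ⊤ ≤ m := by
  rintro _ ⟨S, -, rfl⟩
  have : g ⁻¹' S = ⋃ v ∈ S, {ω | g ω = v} := by ext; simp
  rw [this]
  exact MeasurableSet.biUnion (Set.to_countable S) fun v _ => h v

lemma comap_le_past (N : ℕ → Ω → Node) (X : ℕ → Ω → 𝒳) (Y : ℕ → Ω → ℝ) {s t : ℕ} (hs : 1 ≤ s)
    (hst : s < t) : MeasurableSpace.comap (N s) ⊤ ⊔ MeasurableSpace.comap (X s) inferInstance ⊔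
      MeasurableSpace.comap (Y s) inferInstance ≤ past N X Y t := by
  refine le_trans ?_ (le_sup_left.trans le_sup_left)
  exact le_iSup₂_of_le (f := fun s (_ : s ∈ Finset.Ico 1 t) => MeasurableSpace.comap (N s) ⊤ ⊔
    MeasurableSpace.comap (X s) inferInstance ⊔ MeasurableSpace.comap (Y s) inferInstance) s
    (Finset.mem_Ico.2 ⟨hs, hst⟩) le_rfl

lemma past_mono (N : ℕ → Ω → Node) (X : ℕ → Ω → 𝒳) (Y : ℕ → Ω → ℝ) {i j : ℕ} (hi : 1 ≤ i)
    (hij : i ≤ j) : past N X Y i ≤ past N X Y j := by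
  rcases hij.eq_or_lt with rfl | hij
  · exact le_rfl
  refine sup_le (sup_le (iSup₂_le fun s hs => ?_) ?_) ?_
  · rw [Finset.mem_Ico] at hs
    exact comap_le_past N X Y hs.1 (by omega)
  · exact (le_sup_left.trans le_sup_left).trans (comap_le_past N X Y hi hij)
  · exact (le_sup_right.trans le_sup_left).trans (comap_le_past N X Y hi hij)

lemma measurable_reward_past (N : ℕ → Ω → Node) (X : ℕ → Ω → 𝒳) (Y : ℕ → Ω → ℝ) {t : ℕ}
    (ht : 1 ≤ t) : Measurable[past N X Y (t + 1)] (Y t) :=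
  measurable_iff_comap_le.2 (le_sup_right.trans (comap_le_past N X Y ht (by omega)))

lemma measurable_arm_past (N : ℕ → Ω → Node) (X : ℕ → Ω → 𝒳) (Y : ℕ → Ω → ℝ) (t : ℕ) :
    Measurable[past N X Y t] (X t) :=
  measurable_iff_comap_le.2 le_sup_right

lemma measurableSet_suffix_past (N : ℕ → Ω → Node) (X : ℕ → Ω → 𝒳) (Y : ℕ → Ω → ℝ) (t : ℕ)
    (v : Node) : MeasurableSet[past N X Y t] {ω | v <:+ N t ω} :=
  (le_sup_right.trans le_sup_left : MeasurableSpace.comap (N t) ⊤ ≤ past N X Y t) _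
    ⟨{w | v <:+ w}, trivial, rfl⟩

/-- The truncated reward minus its conditional mean. -/
def noise (M : 𝒳 → Measure ℝ) (X : ℕ → Ω → 𝒳) (Y : ℕ → Ω → ℝ) (t : ℕ) (ω : Ω) : ℝ :=
  clip (Y t ω) - meanPayoff M (X t ω)

lemma abs_noise_le (hM : IsBanditEnvironment M) (t : ℕ) (ω : Ω) : |noise M X Y t ω| ≤ 1 := by
  have h1 := clip_mem (Y t ω)
  have h2 := hM.meanPayoff_mem (X t ω)
  rw [abs_le, noise]
  constructor <;> linarith [h1.1, h1.2, h2.1, h2.2]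

lemma measurable_noise (hM : IsBanditEnvironment M) {t : ℕ} (ht : 1 ≤ t) :
    Measurable[past N X Y (t + 1)] (noise M X Y t) :=
  (measurable_clip.comp (measurable_reward_past N X Y ht)).sub
    (hM.measurable_meanPayoff.comp
      ((measurable_arm_past N X Y t).mono (past_mono N X Y ht (by omega)) le_rfl))

lemma selCount_eq (k n : ℕ) (v : Node) (ω : Ω) :
    selCount (fun t => {ω | v <:+ N (k + t) ω}) n ω = visits (fun t => N (k + t) ω) n v := by
  simp [selCount, Set.indicator_apply, visits, visitRounds]

lemma measureReal_mono_of_ae [MeasurableSpace Ω] {μ : Measure Ω} [IsProbabilityMeasure μ]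
    {p q : Ω → Prop} (h : ∀ᵐ ω ∂μ, p ω → q ω) : μ.real {ω | p ω} ≤ μ.real {ω | q ω} :=
  ENNReal.toReal_mono (measure_ne_top _ _) (measure_mono_ae h)

namespace IsLocalHOORun

variable [MeasurableSpace Ω] {ν₁ ρ : ℝ} {P : Node → Set 𝒳} {μ : Measure Ω}

lemma past_le (h : IsLocalHOORun M ν₁ ρ P μ N X Y) (t : ℕ) :
    past N X Y t ≤ ‹MeasurableSpace Ω› :=
  sup_le (sup_le (iSup₂_le fun s _ => sup_le (sup_le
    (comap_le_of_forall_eq (h.measurable_node s)) (h.measurable_arm s).comap_le)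
    (h.measurable_reward s).comap_le) (comap_le_of_forall_eq (h.measurable_node t)))
    (h.measurable_arm t).comap_le

variable [IsProbabilityMeasure μ]

/-- The reward law is tested on the indicator of the complement of the unit interval. The result
holds only almost surely, which is why the concentration argument uses rewards truncated by `clip`.
-/
lemma reward_mem (hM : IsBanditEnvironment M) (h : IsLocalHOORun M ν₁ ρ P μ N X Y) {t : ℕ}
    (ht : 1 ≤ t) : ∀ᵐ ω ∂μ, Y t ω ∈ Set.Icc (0 : ℝ) 1 := by
  set g : ℝ → ℝ := (Set.Icc (0 : ℝ) 1)ᶜ.indicator fun _ => 1 with hg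
  have hgm : Measurable g := measurable_const.indicator measurableSet_Icc.compl
  have hg0 : ∀ y, 0 ≤ g y := fun y => Set.indicator_nonneg (fun _ _ => zero_le_one) _
  have hg1 : ∀ y, |g y| ≤ 1 := fun y => by
    rw [abs_of_nonneg (hg0 y)]
    exact Set.indicator_apply_le' (fun _ => le_rfl) fun _ => zero_le_one
  have hlaw := h.reward_law t ht g hgm ⟨1, hg1⟩
  have hzero : ∀ x, ∫ y, g y ∂(M x) = 0 := fun x => by
    refine integral_eq_zero_of_ae ((hM.mem_Icc x).mono fun y hy => ?_)
    simp [hg, hy]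
  have hint : Integrable (fun ω => g (Y t ω)) μ :=
    .of_bound (hgm.comp (h.measurable_reward t)).aestronglyMeasurable 1 (.of_forall fun ω => hg1 _)
  have h0 : ∫ ω, g (Y t ω) ∂μ = 0 := by
    rw [← integral_condExp (h.past_le t), integral_congr_ae hlaw]
    simp [hzero]
  rw [integral_eq_zero_iff_of_nonneg (fun ω => hg0 _) hint] at h0
  filter_upwards [h0] with ω hω
  by_contra hmem
  have hmem' : Y t ω ∈ (Set.Icc (0 : ℝ) 1)ᶜ := hmem
  simp only [hg, Set.indicator_of_mem hmem', Pi.zero_apply] at hω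
  exact one_ne_zero hω

/-- The mean of the played arm is known given the past and factors out; the reward law then reduces
the claim to Hoeffding's lemma for a fixed arm. -/
lemma condExp_exp_le (hM : IsBanditEnvironment M) (h : IsLocalHOORun M ν₁ ρ P μ N X Y) {t : ℕ}
    (ht : 1 ≤ t) (s : ℝ) :
    μ[fun ω => Real.exp (s * (clip (Y t ω) - meanPayoff M (X t ω))) | past N X Y t] ≤ᵐ[μ]
      fun _ => Real.exp (s ^ 2 / 8) := by
  set g : ℝ → ℝ := fun y => Real.exp (s * clip y)
  have hgm : Measurable g := Real.measurable_exp.comp (measurable_clip.const_mul s)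
  have hgb : ∀ y, |g y| ≤ Real.exp |s| := fun y => by
    rw [abs_of_pos (Real.exp_pos _)]
    refine Real.exp_le_exp.2 ((le_abs_self _).trans ?_)
    rw [abs_mul, abs_of_nonneg (clip_mem y).1]
    exact mul_le_of_le_one_right (abs_nonneg s) (clip_mem y).2
  set W : Ω → ℝ := fun ω => Real.exp (-(s * meanPayoff M (X t ω)))
  have hWm : Measurable[past N X Y t] W := Real.measurable_exp.comp
    ((hM.measurable_meanPayoff.comp (measurable_arm_past N X Y t)).const_mul s).neg
  have hgint : Integrable (fun ω => g (Y t ω)) μ :=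
    .of_bound (hgm.comp (h.measurable_reward t)).aestronglyMeasurable _ (.of_forall fun ω => hgb _)
  have hWb : ∀ ω, ‖W ω‖ ≤ Real.exp |s| := fun ω => by
    rw [Real.norm_eq_abs, abs_of_pos (Real.exp_pos _)]
    refine Real.exp_le_exp.2 ((le_abs_self _).trans ?_)
    have := hM.meanPayoff_mem (X t ω)
    rw [abs_neg, abs_mul, abs_of_nonneg this.1]
    exact mul_le_of_le_one_right (abs_nonneg s) this.2
  have hWg : Integrable (W * fun ω => g (Y t ω)) μ :=
    hgint.bdd_mul (c := Real.exp |s|)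
      (hWm.mono (h.past_le t) le_rfl).aestronglyMeasurable (.of_forall hWb)
  have heq : (fun ω => Real.exp (s * (clip (Y t ω) - meanPayoff M (X t ω)))) =
      W * fun ω => g (Y t ω) := by
    ext ω
    simp only [W, g, Pi.mul_apply]
    rw [← Real.exp_add]
    ring_nf
  rw [heq]
  filter_upwards [condExp_mul_of_stronglyMeasurable_left (μ := μ) hWm.stronglyMeasurable hWg hgint,
    h.reward_law t ht g hgm ⟨_, hgb⟩] with ω h1 h2
  rw [h1, Pi.mul_apply, h2]
  exact hM.integral_exp_clip_le (X t ω) s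

lemma sum_noise (hM : IsBanditEnvironment M) (h : IsLocalHOORun M ν₁ ρ P μ N X Y) (k n : ℕ)
    (v : Node) : ∀ᵐ ω ∂μ,
      ∑ t ∈ Finset.Icc 1 n, ({ω | v <:+ N (k + t) ω} : Set Ω).indicator (noise M X Y (k + t)) ω =
      ∑ t ∈ visitRounds (fun t => N (k + t) ω) n v,
        (Y (k + t) ω - meanPayoff M (X (k + t) ω)) := by
  classical
  have hYmem : ∀ᵐ ω ∂μ, ∀ t, 1 ≤ t → Y t ω ∈ Set.Icc (0 : ℝ) 1 :=
    ae_all_iff.2 fun t => by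
      by_cases ht : 1 ≤ t
      · exact (h.reward_mem hM ht).mono fun _ hω _ => hω
      · exact .of_forall fun _ h => (ht h).elim
  filter_upwards [hYmem] with ω hω
  rw [visitRounds, Finset.sum_filter]
  refine Finset.sum_congr rfl fun t ht => ?_
  rw [Finset.mem_Icc] at ht
  simp only [Set.indicator_apply, Set.mem_ofPred_eq, noise]
  rw [clip_of_mem (hω _ (by omega))]

/-- The probability that the rewards of a node exceed their conditional means. -/
theorem measureReal_deviates_le (hM : IsBanditEnvironment M)
    (h : IsLocalHOORun M ν₁ ρ P μ N X Y) (k n : ℕ) (v : Node) :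
    μ.real {ω | Deviates (fun t => N (k + t) ω) (fun t => Y (k + t) ω)
        (fun t => meanPayoff M (X (k + t) ω)) n v} ≤ ((n : ℝ) ^ 3)⁻¹ := by
  have key := measureReal_sum_indicator_gt_le (μ := μ) (𝓕 := fun t => past N X Y (k + t))
      (A := fun t => {ω | v <:+ N (k + t) ω}) (ξ := fun t => noise M X Y (k + t))
      (fun t _ => h.past_le (k + t)) (fun i j hi hij => past_mono N X Y (by omega) (by omega))
      (fun t _ => measurableSet_suffix_past N X Y (k + t) v)
      (fun t ht => measurable_noise hM (by omega)) (fun t ω => abs_noise_le hM _ ω)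
      (fun s t ht => h.condExp_exp_le hM (by omega) s) n
  refine le_trans (measureReal_mono_of_ae ?_) key
  filter_upwards [sum_noise hM h k n v] with ω hω hdev
  rw [selCount_eq]
  exact lt_of_lt_of_eq hdev hω.symm

/-- The probability that the rewards of a node fall below their conditional means. -/
theorem measureReal_deviates_swap_le (hM : IsBanditEnvironment M)
    (h : IsLocalHOORun M ν₁ ρ P μ N X Y) (k n : ℕ) (v : Node) :
    μ.real {ω | Deviates (fun t => N (k + t) ω) (fun t => meanPayoff M (X (k + t) ω))
        (fun t => Y (k + t) ω) n v} ≤ ((n : ℝ) ^ 3)⁻¹ := by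
  have key := measureReal_sum_indicator_gt_le (μ := μ) (𝓕 := fun t => past N X Y (k + t))
      (A := fun t => {ω | v <:+ N (k + t) ω}) (ξ := fun t ω => - noise M X Y (k + t) ω)
      (fun t _ => h.past_le (k + t)) (fun i j hi hij => past_mono N X Y (by omega) (by omega))
      (fun t _ => measurableSet_suffix_past N X Y (k + t) v)
      (fun t ht => (measurable_noise hM (by omega)).neg)
      (fun t ω => by rw [abs_neg]; exact abs_noise_le hM _ ω)
      -- The lower tail is the upper tail of the negated noise, so the bound is used at `-s`.
      (fun s t ht => by
        have := h.condExp_exp_le hM (t := k + t) (by omega) (-s)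
        simp only [neg_mul, even_two.neg_pow] at this
        simp only [mul_neg]
        exact this) n
  refine le_trans (measureReal_mono_of_ae ?_) key
  filter_upwards [sum_noise hM h k n v] with ω hω hdev
  have hneg : ∑ t ∈ Finset.Icc 1 n, ({ω | v <:+ N (k + t) ω} : Set Ω).indicator
      (fun ω => - noise M X Y (k + t) ω) ω = - ∑ t ∈ Finset.Icc 1 n,
        ({ω | v <:+ N (k + t) ω} : Set Ω).indicator (noise M X Y (k + t)) ω := by
    rw [← Finset.sum_neg_distrib]
    refine Finset.sum_congr rfl fun t _ => ?_
    by_cases hmem : v <:+ N (k + t) ω <;> simp [hmem]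
  rw [selCount_eq, hneg, hω, ← Finset.sum_neg_distrib]
  simp only [neg_sub]
  exact hdev

end IsLocalHOORun

end Rewards

/-! ### Near-optimal regions -/

section Geometry

lemma le_of_diam_le {𝒳 : Type*} {l : 𝒳 → 𝒳 → ℝ} {A : Set 𝒳} {D : ℝ} (hD : 0 ≤ D) (h : diam l A ≤ ENNReal.ofReal D) {x y : 𝒳}
    (hx : x ∈ A) (hy : y ∈ A) : l x y ≤ D := by
  refine (ENNReal.ofReal_le_ofReal_iff hD).1 (le_trans ?_ h)
  exact (le_iSup₂ (f := fun y (_ : y ∈ A) => ENNReal.ofReal (l x y)) y hy).trans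
    (le_iSup₂ (f := fun x (_ : x ∈ A) => ⨆ y ∈ A, ENNReal.ofReal (l x y)) x hx)

variable {𝒳 : Type*} [MeasurableSpace 𝒳] {M : 𝒳 → Measure ℝ} {ν₁ ρ : ℝ} {P : Node → Set 𝒳}
  {l : 𝒳 → 𝒳 → ℝ} {ν₂ ε₀ L C d : ℝ}

lemma IsBanditEnvironment.bddAbove (hM : IsBanditEnvironment M) :
    BddAbove (Set.range (meanPayoff M)) :=
  ⟨1, by rintro _ ⟨x, rfl⟩; exact (hM.meanPayoff_mem x).2⟩

lemma IsBanditEnvironment.le_bestPayoff (hM : IsBanditEnvironment M) (x : 𝒳) :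
    meanPayoff M x ≤ bestPayoff M := le_ciSup hM.bddAbove x

lemma IsBanditEnvironment.bestPayoff_le_one (hM : IsBanditEnvironment M) : bestPayoff M ≤ 1 :=
  Real.iSup_le (fun x => (hM.meanPayoff_mem x).2) zero_le_one

lemma IsTreeOfCoverings.region_anti (hP : IsTreeOfCoverings P) {v w : Node} (h : v <:+ w) :
    P w ⊆ P v := by
  induction w with
  | nil => rw [List.suffix_nil.1 h]
  | cons b w ih =>
    rcases List.suffix_cons_iff.1 h with rfl | h
    · exact subset_rfl
    · refine Set.Subset.trans ?_ (ih h)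
      rw [hP.children w]
      cases b
      · exact Set.subset_union_left
      · exact Set.subset_union_right

/-- The region of `v` contains an arm which is better than `2 ν₁ ρ ^ h`-optimal, where `h` is the
depth of `v`. -/
def IsPromising (M : 𝒳 → Measure ℝ) (ν₁ ρ : ℝ) (P : Node → Set 𝒳) (v : Node) : Prop :=
  ∃ x ∈ P v, bestPayoff M - 2 * (ν₁ * ρ ^ v.length) < meanPayoff M x

lemma IsPromising.regret_le (hM : IsBanditEnvironment M) {v : Node}
    (hv : IsPromising M ν₁ ρ P v) (hD : 0 < ν₁ * ρ ^ v.length)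
    (hε : 4 * (ν₁ * ρ ^ v.length) ≤ ε₀) (hA1 : ShrinkingRegions ν₁ ρ P l ν₂)
    (hA2 : LocallyWeaklyLipschitz M l ε₀ L) {y : 𝒳} (hy : y ∈ P v) :
    bestPayoff M - meanPayoff M y ≤ 4 * L * (ν₁ * ρ ^ v.length) := by
  obtain ⟨x, hx, hfx⟩ := hv
  set D := ν₁ * ρ ^ v.length
  set δ := bestPayoff M - meanPayoff M x with hδ
  have hδ0 : 0 ≤ δ := sub_nonneg.2 (hM.le_bestPayoff x)
  have hl : l x y ≤ D := le_of_diam_le hD.le (hA1.1 v) hx hy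
  have hmem : x ∈ nearOptimal M ε₀ := by
    change bestPayoff M - ε₀ ≤ meanPayoff M x
    linarith
  -- The slack `4D - 2δ` is nonnegative because `δ < 2D`. It makes the radius `4D - δ` exceed `D`,
  -- and the resulting optimality gap `L(2δ + 4D - 2δ) = 4LD` no longer depends on `x`.
  have hball : y ∈ ball l x (δ + (4 * D - 2 * δ)) := by
    change l x y < _
    linarith
  have := hA2.2 x hmem (4 * D - 2 * δ) (by linarith) (by linarith) hball
  change bestPayoff M - L * (2 * δ + (4 * D - 2 * δ)) ≤ meanPayoff M y at this
  linarith

/-- The packing hypothesis is used at radius `ν₂ρ^h`: its constant `4Lν₁/ν₂` turns this radius into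
the gap `4Lν₁ρ^h` of the promising regions, which contain the balls. -/
lemma card_promising_le (hM : IsBanditEnvironment M) (hl : IsDissimilarity l) (hν₁ : 0 < ν₁)
    (hρ : 0 < ρ) (hν₂ : 0 < ν₂) (hC : 0 ≤ C) (hA1 : ShrinkingRegions ν₁ ρ P l ν₂)
    (hA2 : LocallyWeaklyLipschitz M l ε₀ L)
    (hA3 : NearOptimalPacking M l ε₀ (4 * L * ν₁ / ν₂) C d) {h : ℕ}
    (hε₁ : 4 * (ν₁ * ρ ^ h) ≤ ε₀) (hε₂ : ν₂ * ρ ^ h ≤ ε₀) {S : Finset Node}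
    (hS : ∀ v ∈ S, v.length = h ∧ IsPromising M ν₁ ρ P v) :
    (S.card : ℝ) ≤ C * (ν₂ * ρ ^ h) ^ (-d) := by
  classical
  obtain ⟨c, hc, hdisj⟩ := hA1.2
  have hr : 0 < ν₂ * ρ ^ h := by positivity
  have hself : ∀ x, x ∈ ball l x (ν₂ * ρ ^ h) := fun x => by
    change l x x < _
    rwa [hl.self]
  have hdis : ∀ v ∈ S, ∀ w ∈ S, v ≠ w →
      Disjoint (ball l (c v) (ν₂ * ρ ^ h)) (ball l (c w) (ν₂ * ρ ^ h)) := by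
    intro v hv w hw hvw
    have := hdisj v w ((hS v hv).1.trans (hS w hw).1.symm) hvw
    rwa [(hS v hv).1, (hS w hw).1] at this
  have hinj : Set.InjOn c S := by
    intro v hv w hw hvw
    by_contra hne
    refine Set.disjoint_left.1 (hdis v hv w hw hne) (hself (c v)) ?_
    rw [hvw]
    exact hself (c w)
  have hpack : ((S.image c).card : ℕ∞) ≤
      packingNumber l (nearOptimal M (4 * L * ν₁ / ν₂ * (ν₂ * ρ ^ h))) (ν₂ * ρ ^ h) := by
    refine le_iSup₂_of_le (f := fun (s : Finset 𝒳) (_ : (∀ x ∈ s, ball l x (ν₂ * ρ ^ h) ⊆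
      nearOptimal M (4 * L * ν₁ / ν₂ * (ν₂ * ρ ^ h))) ∧ (s : Set 𝒳).Pairwise fun x y =>
        Disjoint (ball l x (ν₂ * ρ ^ h)) (ball l y (ν₂ * ρ ^ h))) => (s.card : ℕ∞))
      (S.image c) ⟨?_, ?_⟩ le_rfl
    · intro x hx
      obtain ⟨v, hv, rfl⟩ := Finset.mem_image.1 hx
      obtain ⟨hlen, hprom⟩ := hS v hv
      intro y hy
      have hyP : y ∈ P v := by
        refine (hc v).2 ?_
        rwa [hlen]
      have := hprom.regret_le hM (by rw [hlen]; positivity) (by rwa [hlen]) hA1 hA2 hyP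
      rw [hlen] at this
      change bestPayoff M - 4 * L * ν₁ / ν₂ * (ν₂ * ρ ^ h) ≤ meanPayoff M y
      have heq : 4 * L * ν₁ / ν₂ * (ν₂ * ρ ^ h) = 4 * L * (ν₁ * ρ ^ h) := by field_simp
      linarith
    · intro x hx y hy hxy
      obtain ⟨v, hv, rfl⟩ := Finset.mem_image.1 (Finset.mem_coe.1 hx)
      obtain ⟨w, hw, rfl⟩ := Finset.mem_image.1 (Finset.mem_coe.1 hy)
      exact hdis v hv w hw fun h => hxy (h ▸ rfl)
  rw [Finset.card_image_of_injOn hinj] at hpack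
  have h1 := (ENat.toENNReal_le.2 hpack).trans (hA3 _ hr hε₂)
  rw [ENat.toENNReal_coe] at h1
  have h2 := ENNReal.toReal_mono ENNReal.ofReal_ne_top h1
  rwa [ENNReal.toReal_natCast, ENNReal.toReal_ofReal (by positivity)] at h2

/-- There is a path of regions each of which contains arms as good as possible. -/
lemma exists_optimal_path (hP : IsTreeOfCoverings P) [Nonempty 𝒳] :
    ∃ o : ℕ → Node, (∀ h, (o h).length = h) ∧ (∀ h, ∃ b, o (h + 1) = b :: o h) ∧
      ∀ h, ∀ a < bestPayoff M, ∃ x ∈ P (o h), a < meanPayoff M x := by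
  set Opt : Node → Prop := fun v => ∀ a < bestPayoff M, ∃ x ∈ P v, a < meanPayoff M x
  have hroot : Opt [] := fun a ha => by
    obtain ⟨x, hx⟩ := exists_lt_of_lt_ciSup ha
    exact ⟨x, by rw [hP.root]; trivial, hx⟩
  -- The supremum need not be attained. If each child missed it below some threshold, the larger
  -- threshold would contradict the supremum over the parent.
  have hstep : ∀ v, Opt v → ∃ b, Opt (b :: v) := by
    intro v hv
    by_contra! hcon
    have h0 := hcon false
    have h1 := hcon true
    simp only [Opt, not_forall, not_exists, not_and, not_lt] at h0 h1
    obtain ⟨a, ha, hxa⟩ := h0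
    obtain ⟨a', ha', hxa'⟩ := h1
    obtain ⟨x, hx, hlt⟩ := hv (max a a') (max_lt ha ha')
    rw [hP.children v] at hx
    rcases hx with hx | hx
    · exact absurd ((le_max_left a a').trans_lt hlt) (not_lt.2 (hxa x hx))
    · exact absurd ((le_max_right a a').trans_lt hlt) (not_lt.2 (hxa' x hx))
  choose b hb using hstep
  let p : ℕ → {v // Opt v} := fun h =>
    Nat.rec ⟨[], hroot⟩ (fun _ v => ⟨b v.1 v.2 :: v.1, hb v.1 v.2⟩) h
  refine ⟨fun h => (p h).1, fun h => ?_, fun h => ⟨b (p h).1 (p h).2, rfl⟩, fun h => (p h).2⟩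
  induction h with
  | zero => rfl
  | succ h ih => exact congrArg (· + 1) ih

lemma regret_le_of_optimal (hM : IsBanditEnvironment M) {v : Node}
    (hv : ∀ a < bestPayoff M, ∃ x ∈ P v, a < meanPayoff M x) (hD : 0 ≤ ν₁ * ρ ^ v.length)
    (hε : ν₁ * ρ ^ v.length ≤ ε₀) (hA1 : ShrinkingRegions ν₁ ρ P l ν₂)
    (hA2 : LocallyWeaklyLipschitz M l ε₀ L) {x : 𝒳} (hx : x ∈ P v) :
    bestPayoff M - ν₁ * ρ ^ v.length ≤ meanPayoff M x := by
  have hsup : sSup (meanPayoff M '' P v) = bestPayoff M := by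
    refine csSup_eq_of_forall_le_of_forall_lt_exists_gt ⟨_, x, hx, rfl⟩ ?_ ?_
    · rintro _ ⟨y, -, rfl⟩
      exact hM.le_bestPayoff y
    · intro a ha
      obtain ⟨y, hy, hay⟩ := hv a ha
      exact ⟨_, ⟨y, hy, rfl⟩, hay⟩
  have h1 := (hA2.1 (P v) ⟨x, hx⟩ hsup ((hA1.1 v).trans (ENNReal.ofReal_le_ofReal hε))).trans
    (hA1.1 v)
  rw [ENNReal.ofReal_le_ofReal_iff hD] at h1
  have h2 : sInf (meanPayoff M '' P v) ≤ meanPayoff M x :=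
    csInf_le ⟨0, by rintro _ ⟨y, -, rfl⟩; exact (hM.meanPayoff_mem y).1⟩ ⟨x, hx, rfl⟩
  linarith

end Geometry

/-! ### Regret along a run -/

section Levels

/-- The children of the nodes of `S`. -/
def childNodes (S : Finset Node) : Finset Node :=
  S.image (List.cons false) ∪ S.image (List.cons true)

/-- The nodes of depth `h`. -/
def level : ℕ → Finset Node
  | 0 => {[]}
  | h + 1 => childNodes (level h)

lemma mem_childNodes {S : Finset Node} {v : Node} :
    v ∈ childNodes S ↔ ∃ b, ∃ w ∈ S, v = b :: w := by
  simp only [childNodes, Finset.mem_union, Finset.mem_image, Bool.exists_bool, eq_comm]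

lemma card_childNodes_le (S : Finset Node) : (childNodes S).card ≤ 2 * S.card := by
  refine (Finset.card_union_le _ _).trans ?_
  rw [two_mul]
  exact add_le_add Finset.card_image_le Finset.card_image_le

lemma mem_level {h : ℕ} {v : Node} : v ∈ level h ↔ v.length = h := by
  induction h generalizing v with
  | zero => simp [level]
  | succ h ih =>
    rw [level, mem_childNodes]
    cases v with
    | nil => simp
    | cons b v => simp [ih]

lemma card_level_le (h : ℕ) : (level h).card ≤ 2 ^ h := by
  induction h with
  | zero => simp [level]
  | succ h ih =>
    rw [level, pow_succ]
    have := card_childNodes_le (level h)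
    omega

lemma exists_cons_suffix {v w : Node} (h : v <:+ w) (hne : v ≠ w) : ∃ b, b :: v <:+ w := by
  obtain ⟨t, rfl⟩ := h
  rcases List.eq_nil_or_concat t with rfl | ⟨t', b, rfl⟩
  · exact (hne rfl).elim
  · exact ⟨b, t', by simp⟩

end Levels

section Pathwise

variable {𝒳 : Type*} {M : 𝒳 → Measure ℝ} {ν₁ ρ : ℝ} {P : Node → Set 𝒳}
  {l : 𝒳 → 𝒳 → ℝ} {ν₂ ε₀ L C d : ℝ}

open Classical in
/-- The promising nodes of depth `h`. -/
def promisingLevel (M : 𝒳 → Measure ℝ) (ν₁ ρ : ℝ) (P : Node → Set 𝒳) (h : ℕ) : Finset Node :=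
  (level h).filter (IsPromising M ν₁ ρ P)

open Classical in
/-- The nodes of depth `h` which are not promising. -/
def unpromisingLevel (M : 𝒳 → Measure ℝ) (ν₁ ρ : ℝ) (P : Node → Set 𝒳) (h : ℕ) : Finset Node :=
  (level h).filter fun v => ¬ IsPromising M ν₁ ρ P v

open Classical in
/-- The children of the promising nodes of depth `h` which are not promising. -/
def fringe (M : 𝒳 → Measure ℝ) (ν₁ ρ : ℝ) (P : Node → Set 𝒳) (h : ℕ) : Finset Node :=
  (childNodes (promisingLevel M ν₁ ρ P h)).filter fun v => ¬ IsPromising M ν₁ ρ P v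

lemma mem_promisingLevel {h : ℕ} {v : Node} :
    v ∈ promisingLevel M ν₁ ρ P h ↔ v.length = h ∧ IsPromising M ν₁ ρ P v := by
  simp [promisingLevel, mem_level]

lemma mem_unpromisingLevel {h : ℕ} {v : Node} :
    v ∈ unpromisingLevel M ν₁ ρ P h ↔ v.length = h ∧ ¬ IsPromising M ν₁ ρ P v := by
  simp [unpromisingLevel, mem_level]

lemma mem_fringe {h : ℕ} {v : Node} : v ∈ fringe M ν₁ ρ P h ↔
    (∃ b, ∃ w ∈ promisingLevel M ν₁ ρ P h, v = b :: w) ∧ ¬ IsPromising M ν₁ ρ P v := by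
  simp [fringe, mem_childNodes]

lemma length_of_mem_fringe {h : ℕ} {v : Node} (hv : v ∈ fringe M ν₁ ρ P h) :
    v.length = h + 1 := by
  obtain ⟨⟨b, w, hw, rfl⟩, -⟩ := mem_fringe.1 hv
  simp [(mem_promisingLevel.1 hw).1]

lemma card_unpromisingLevel_le (h : ℕ) : (unpromisingLevel M ν₁ ρ P h).card ≤ 2 ^ h := by
  classical exact (Finset.card_filter_le _ _).trans (card_level_le h)

lemma card_fringe_le (h : ℕ) :
    (fringe M ν₁ ρ P h).card ≤ 2 * (promisingLevel M ν₁ ρ P h).card := by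
  classical exact (Finset.card_filter_le _ _).trans (card_childNodes_le _)

/-- Every node of depth at least `z` descends from an unpromising node of depth `z`, or from a fringe
node, or is promising, or descends from a promising node of depth `k`. -/
lemma node_cases {z k : ℕ} (hzk : z ≤ k) {w : Node} (hw : z ≤ w.length) :
    (∃ v ∈ unpromisingLevel M ν₁ ρ P z, v <:+ w) ∨
    (∃ h ∈ Finset.Ico z k, ∃ v ∈ fringe M ν₁ ρ P h, v <:+ w) ∨
    (∃ h ∈ Finset.Ico z k, w ∈ promisingLevel M ν₁ ρ P h) ∨
    ∃ v ∈ promisingLevel M ν₁ ρ P k, v <:+ w := by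
  induction k, hzk using Nat.le_induction with
  | base =>
    -- Words grow at the head, so dropping letters from the head yields the ancestor of depth `z`.
    have hlen : (w.drop (w.length - z)).length = z := by rw [List.length_drop]; omega
    by_cases hp : IsPromising M ν₁ ρ P (w.drop (w.length - z))
    · exact .inr (.inr (.inr ⟨_, mem_promisingLevel.2 ⟨hlen, hp⟩, List.drop_suffix _ _⟩))
    · exact .inl ⟨_, mem_unpromisingLevel.2 ⟨hlen, hp⟩, List.drop_suffix _ _⟩
  | succ k hzk ih =>
    have hsub : ∀ h ∈ Finset.Ico z k, h ∈ Finset.Ico z (k + 1) := fun h hh => by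
      rw [Finset.mem_Ico] at *; omega
    have hk : k ∈ Finset.Ico z (k + 1) := by rw [Finset.mem_Ico]; omega
    rcases ih with h1 | ⟨h, hh, h2⟩ | ⟨h, hh, h3⟩ | ⟨v, hv, hvw⟩
    · exact .inl h1
    · exact .inr (.inl ⟨h, hsub h hh, h2⟩)
    · exact .inr (.inr (.inl ⟨h, hsub h hh, h3⟩))
    · by_cases hne : v = w
      · exact .inr (.inr (.inl ⟨k, hk, hne ▸ hv⟩))
      · obtain ⟨b, hb⟩ := exists_cons_suffix hvw hne
        by_cases hp : IsPromising M ν₁ ρ P (b :: v)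
        · refine .inr (.inr (.inr ⟨_, mem_promisingLevel.2 ⟨?_, hp⟩, hb⟩))
          simp [(mem_promisingLevel.1 hv).1]
        · exact .inr (.inl ⟨k, hk, _, mem_fringe.2 ⟨⟨b, v, hv, rfl⟩, hp⟩, hb⟩)

/-- At time `n`, the rewards of some node of the path `o` of depth at least `z` have been too
low. -/
def PathDeviates (z : ℕ) (o : ℕ → Node) (H : ℕ → Node) (Y F : ℕ → ℝ) (n : ℕ) : Prop :=
  ∃ h ∈ Finset.Icc z (z + n), Deviates H F Y n (o h)

open Classical in
/-- The indicator of a proposition. -/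
def ind (p : Prop) : ℝ := if p then 1 else 0

lemma ind_of {p : Prop} (h : p) : ind p = 1 := if_pos h

lemma ind_of_not {p : Prop} (h : ¬ p) : ind p = 0 := if_neg h

lemma ind_nonneg (p : Prop) : 0 ≤ ind p := by
  unfold ind; split_ifs <;> norm_num

lemma sum_ind {ι : Type*} (s : Finset ι) (p : ι → Prop) [DecidablePred p] :
    ∑ i ∈ s, ind (p i) = (s.filter p).card := by
  rw [Finset.natCast_card_filter]
  exact Finset.sum_congr rfl fun i _ => by by_cases h : p i <;> simp [ind, h]

lemma one_le_sum_mul_ind {ι : Type*} {s : Finset ι} {p : ι → Prop} {i : ι} (hi : i ∈ s)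
    (hp : p i) : 1 ≤ ∑ i ∈ s, ind (p i) := by
  rw [← ind_of hp]
  exact Finset.single_le_sum (f := fun i => ind (p i)) (fun i _ => ind_nonneg _) hi

variable [MeasurableSpace 𝒳] {H : ℕ → Node} {Y : ℕ → ℝ} {x : ℕ → 𝒳} {m z : ℕ} {o : ℕ → Node}

/-- The number of visits of an unpromising node. -/
lemma sum_ind_visits_le (hP : IsTreeOfCoverings P) (hM : IsBanditEnvironment M) (hν₁ : 0 < ν₁)
    (hρ0 : 0 < ρ) (hρ1 : ρ ≤ 1)
    (hplay : ∀ n < m, CanPlay z ν₁ ρ H Y n (H (n + 1)))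
    (hx : ∀ t, 1 ≤ t → t ≤ m → x t ∈ P (H t))
    (hlen : ∀ h, (o h).length = h) (hchild : ∀ h, ∃ b, o (h + 1) = b :: o h)
    (hopt : ∀ h, ∀ a < bestPayoff M, ∃ x ∈ P (o h), a < meanPayoff M x)
    (hε : ν₁ * ρ ^ z ≤ ε₀) (hA1 : ShrinkingRegions ν₁ ρ P l ν₂)
    (hA2 : LocallyWeaklyLipschitz M l ε₀ L) {v : Node} (hz : z ≤ v.length)
    (hv : ¬ IsPromising M ν₁ ρ P v) :
    ∑ n ∈ Finset.range m, ind (v <:+ H (n + 1) ∧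
      ¬ PathDeviates z o H Y (fun t => meanPayoff M (x t)) n) ≤
    8 * Real.log m / (ν₁ * ρ ^ v.length) ^ 2 + 2 +
      ∑ n ∈ Finset.range m, ind (Deviates H Y (fun t => meanPayoff M (x t)) n v) := by
  classical
  set F : ℕ → ℝ := fun t => meanPayoff M (x t)
  -- Rounds in which the confidence bound of `v` itself fails are counted separately.
  have hsplit : ∑ n ∈ Finset.range m, ind (v <:+ H (n + 1) ∧ ¬ PathDeviates z o H Y F n) ≤
      ∑ n ∈ Finset.range m, (ind ((v <:+ H (n + 1) ∧ ¬ PathDeviates z o H Y F n) ∧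
        ¬ Deviates H Y F n v) + ind (Deviates H Y F n v)) := by
    refine Finset.sum_le_sum fun n _ => ?_
    by_cases h1 : Deviates H Y F n v
    · by_cases h2 : v <:+ H (n + 1) ∧ ¬ PathDeviates z o H Y F n <;> simp [ind, h1, h2]
    · rw [ind_of_not h1]; simp [h1]
  refine hsplit.trans ?_
  rw [Finset.sum_add_distrib]
  refine add_le_add_left ?_ _
  rw [sum_ind]
  refine card_le_of_visits_le hplay (v := v)
    (div_nonneg (mul_nonneg (by norm_num) (Real.log_natCast_nonneg m)) (sq_nonneg _)) ?_ ?_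
  · intro n hn
    rw [Finset.mem_filter, Finset.mem_range] at hn
    exact ⟨hn.1, hn.2.1.1⟩
  · intro n hn hne
    rw [Finset.mem_filter, Finset.mem_range] at hn
    obtain ⟨hnm, ⟨hvH, hpath⟩, hdev⟩ := hn
    have hU : ∀ h, z ≤ h → ((bestPayoff M : ℝ) : EReal) ≤ uValue ν₁ ρ H Y n (o h) := by
      intro h hzh
      refine le_uValue (F := F) ?_ ?_
      · intro t ht
        rw [mem_visitRounds] at ht
        refine regret_le_of_optimal hM (hopt h) (by positivity) ?_ hA1 hA2
          (hP.region_anti ht.2 (hx t ht.1.1 (by omega)))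
        rw [hlen]
        exact (mul_le_mul_of_nonneg_left (pow_le_pow_of_le_one hρ0.le hρ1 hzh) hν₁.le).trans hε
      · by_cases hh : h ≤ z + n
        · exact fun hd => hpath ⟨h, Finset.mem_Icc.2 ⟨hzh, hh⟩, hd⟩
        -- Each round deepens the tree by at most one level beyond `z`, so nodes deeper than `z + n`
        -- have no visits. Hence finitely many depths suffice in `PathDeviates`.
        · refine not_deviates_of_visits_eq_zero ?_
          rw [visits, Finset.card_eq_zero, Finset.eq_empty_iff_forall_notMem]
          intro t ht
          rw [mem_visitRounds] at ht
          have h1 := length_le_of_canPlay hplay t ht.1.1 (by omega)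
          have h2 := ht.2.length_le
          rw [hlen] at h2
          omega
    have hUv := le_uValue_of_canPlay hlen hchild hU (hplay n hnm) hvH hne hz
    have hvis := visits_le_of_le_uValue (F := F) (by positivity) ?_ hdev hUv
    · refine hvis.trans ?_
      rcases Nat.eq_zero_or_pos n with rfl | hn0
      · simp only [Nat.cast_zero, Real.log_zero, mul_zero, zero_div]
        exact div_nonneg (mul_nonneg (by norm_num) (Real.log_natCast_nonneg m)) (sq_nonneg _)
      · gcongr
    · intro t ht
      rw [mem_visitRounds] at ht
      by_contra! hlt
      exact hv ⟨x t, hP.region_anti ht.2 (hx t ht.1.1 (by omega)), hlt⟩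

/-- The regret of one round. -/
lemma round_regret_le (hP : IsTreeOfCoverings P) (hM : IsBanditEnvironment M) (hν₁ : 0 < ν₁)
    (hρ0 : 0 < ρ) (hρ1 : ρ ≤ 1) (hL : 0 ≤ L) (hε : 4 * (ν₁ * ρ ^ z) ≤ ε₀)
    (hA1 : ShrinkingRegions ν₁ ρ P l ν₂) (hA2 : LocallyWeaklyLipschitz M l ε₀ L) {k : ℕ}
    (hzk : z ≤ k) {w : Node} (hw : z ≤ w.length) {y : 𝒳} (hy : y ∈ P w) (p : Prop) :
    bestPayoff M - meanPayoff M y ≤ ind p +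
      ∑ v ∈ unpromisingLevel M ν₁ ρ P z, ind (v <:+ w ∧ ¬ p) +
      ∑ h ∈ Finset.Ico z k, 4 * L * (ν₁ * ρ ^ h) *
        ∑ v ∈ fringe M ν₁ ρ P h, ind (v <:+ w ∧ ¬ p) +
      ∑ h ∈ Finset.Ico z k, 4 * L * (ν₁ * ρ ^ h) *
        ∑ v ∈ promisingLevel M ν₁ ρ P h, ind (v = w) +
      4 * L * (ν₁ * ρ ^ k) := by
  have hc : ∀ h, 0 ≤ 4 * L * (ν₁ * ρ ^ h) := fun h => by positivity
  have t0 := ind_nonneg p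
  have t1 : 0 ≤ ∑ v ∈ unpromisingLevel M ν₁ ρ P z, ind (v <:+ w ∧ ¬ p) :=
    Finset.sum_nonneg fun _ _ => ind_nonneg _
  have t2' : ∀ h ∈ Finset.Ico z k, 0 ≤ 4 * L * (ν₁ * ρ ^ h) *
      ∑ v ∈ fringe M ν₁ ρ P h, ind (v <:+ w ∧ ¬ p) :=
    fun h _ => mul_nonneg (hc h) (Finset.sum_nonneg fun _ _ => ind_nonneg _)
  have t3' : ∀ h ∈ Finset.Ico z k, 0 ≤ 4 * L * (ν₁ * ρ ^ h) *
      ∑ v ∈ promisingLevel M ν₁ ρ P h, ind (v = w) :=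
    fun h _ => mul_nonneg (hc h) (Finset.sum_nonneg fun _ _ => ind_nonneg _)
  have t2 := Finset.sum_nonneg t2'
  have t3 := Finset.sum_nonneg t3'
  have t4 := hc k
  have hone : bestPayoff M - meanPayoff M y ≤ 1 := by
    linarith [hM.bestPayoff_le_one, (hM.meanPayoff_mem y).1]
  have hreg : ∀ h, z ≤ h → ∀ v ∈ promisingLevel M ν₁ ρ P h, v <:+ w →
      bestPayoff M - meanPayoff M y ≤ 4 * L * (ν₁ * ρ ^ h) := by
    intro h hzh v hv hvw
    obtain ⟨hvl, hvp⟩ := mem_promisingLevel.1 hv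
    have := hvp.regret_le hM (by positivity) (ε₀ := ε₀) ?_ hA1 hA2 (hP.region_anti hvw hy)
    · rwa [hvl] at this
    · rw [hvl]
      refine le_trans ?_ hε
      have := pow_le_pow_of_le_one hρ0.le hρ1 hzh
      gcongr
  by_cases hp : p
  · rw [ind_of hp]
    linarith
  · rcases node_cases (M := M) (ν₁ := ν₁) (ρ := ρ) (P := P) hzk hw with
      ⟨v, hv, hvw⟩ | ⟨h, hh, v, hv, hvw⟩ | ⟨h, hh, hwp⟩ | ⟨v, hv, hvw⟩
    -- An unpromising node at the starting depth need not have a promising parent, so only the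
    -- trivial bound `1` is available.
    · have := one_le_sum_mul_ind (p := fun v => v <:+ w ∧ ¬ p) hv ⟨hvw, hp⟩
      linarith
    · have h1 := one_le_sum_mul_ind (p := fun v => v <:+ w ∧ ¬ p) hv ⟨hvw, hp⟩
      have h2 := Finset.single_le_sum t2' hh
      have h3 := mul_le_mul_of_nonneg_left h1 (hc h)
      -- The fringe node is not promising, but its parent is, and the arm lies in the parent's
      -- region.
      obtain ⟨⟨b, u, hu, rfl⟩, -⟩ := mem_fringe.1 hv
      have h4 := hreg h (Finset.mem_Ico.1 hh).1 u hu ((List.suffix_cons b u).trans hvw)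
      linarith
    · have h1 := one_le_sum_mul_ind (p := fun v => v = w) hwp rfl
      have h2 := Finset.single_le_sum t3' hh
      have h3 := mul_le_mul_of_nonneg_left h1 (hc h)
      have h4 := hreg h (Finset.mem_Ico.1 hh).1 w hwp List.suffix_rfl
      linarith
    · have := hreg k hzk v hv hvw
      linarith

/-- The regret of a run of `z`-HOO. -/
theorem run_regret_le (hP : IsTreeOfCoverings P) (hM : IsBanditEnvironment M) (hν₁ : 0 < ν₁)
    (hρ0 : 0 < ρ) (hρ1 : ρ ≤ 1) (hL : 0 ≤ L)
    (hplay : ∀ n < m, CanPlay z ν₁ ρ H Y n (H (n + 1)))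
    (hx : ∀ t, 1 ≤ t → t ≤ m → x t ∈ P (H t))
    (hlen : ∀ h, (o h).length = h) (hchild : ∀ h, ∃ b, o (h + 1) = b :: o h)
    (hopt : ∀ h, ∀ a < bestPayoff M, ∃ x ∈ P (o h), a < meanPayoff M x)
    (hε : 4 * (ν₁ * ρ ^ z) ≤ ε₀) (hA1 : ShrinkingRegions ν₁ ρ P l ν₂)
    (hA2 : LocallyWeaklyLipschitz M l ε₀ L) {k : ℕ} (hzk : z ≤ k) :
    ∑ n ∈ Finset.range m, (bestPayoff M - meanPayoff M (x (n + 1))) ≤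
      ∑ n ∈ Finset.range m, ind (PathDeviates z o H Y (fun t => meanPayoff M (x t)) n) +
      ∑ v ∈ unpromisingLevel M ν₁ ρ P z, (8 * Real.log m / (ν₁ * ρ ^ v.length) ^ 2 + 2 +
        ∑ n ∈ Finset.range m, ind (Deviates H Y (fun t => meanPayoff M (x t)) n v)) +
      ∑ h ∈ Finset.Ico z k, 4 * L * (ν₁ * ρ ^ h) *
        ∑ v ∈ fringe M ν₁ ρ P h, (8 * Real.log m / (ν₁ * ρ ^ v.length) ^ 2 + 2 +
          ∑ n ∈ Finset.range m, ind (Deviates H Y (fun t => meanPayoff M (x t)) n v)) +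
      ∑ h ∈ Finset.Ico z k, 4 * L * (ν₁ * ρ ^ h) * (promisingLevel M ν₁ ρ P h).card +
      m * (4 * L * (ν₁ * ρ ^ k)) := by
  classical
  set F : ℕ → ℝ := fun t => meanPayoff M (x t)
  have hvisit : ∀ v : Node, z ≤ v.length → ¬ IsPromising M ν₁ ρ P v → _ := fun v hz hv =>
    sum_ind_visits_le hP hM hν₁ hρ0 hρ1 hplay hx hlen hchild hopt
      (by have : 0 < ν₁ * ρ ^ z := by positivity
          linarith) hA1 hA2 hz hv
  have hround := Finset.sum_le_sum fun n (hn : n ∈ Finset.range m) =>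
    round_regret_le hP hM hν₁ hρ0 hρ1 hL hε hA1 hA2 hzk
      (hplay n (Finset.mem_range.1 hn)).1.le_length
      (hx (n + 1) (by omega) (Finset.mem_range.1 hn)) (PathDeviates z o H Y F n)
  refine hround.trans ?_
  simp only [Finset.sum_add_distrib]
  refine add_le_add (add_le_add (add_le_add (add_le_add le_rfl ?_) ?_) ?_) ?_
  · rw [← Finset.sum_add_distrib, Finset.sum_comm, ← Finset.sum_add_distrib]
    refine Finset.sum_le_sum fun v hv => ?_
    obtain ⟨h1, h2⟩ := mem_unpromisingLevel.1 hv
    exact hvisit v h1.ge h2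
  · rw [Finset.sum_comm]
    refine Finset.sum_le_sum fun h hh => ?_
    rw [← Finset.mul_sum, ← Finset.sum_add_distrib, ← Finset.sum_add_distrib, Finset.sum_comm]
    refine mul_le_mul_of_nonneg_left (Finset.sum_le_sum fun v hv => ?_) (by positivity)
    refine hvisit v ?_ (mem_fringe.1 hv).2
    rw [length_of_mem_fringe hv]
    have := (Finset.mem_Ico.1 hh).1
    omega
  · rw [Finset.sum_comm]
    refine Finset.sum_le_sum fun h hh => ?_
    rw [← Finset.mul_sum, Finset.sum_comm]
    refine mul_le_mul_of_nonneg_left ?_ (by positivity)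
    -- No node is played twice within a regime, so each promising node contributes at most one
    -- round.
    refine (Finset.sum_le_card_nsmul _ _ 1 fun v _ => ?_).trans (by simp)
    rw [sum_ind]
    have : ((Finset.range m).filter fun n => v = H (n + 1)).card ≤ 1 := by
      rw [Finset.card_le_one]
      intro a ha b hb
      rw [Finset.mem_filter, Finset.mem_range] at ha hb
      have := injOn_of_canPlay hplay (x₁ := a + 1) (x₂ := b + 1)
        (by simpa using ha.1) (by simpa using hb.1) (ha.2.symm.trans hb.2)
      omega
    exact_mod_cast this
  · simp

end Pathwise

/-! ### Expected regret of one regime -/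

section Indicator

variable {Ω : Type*}

lemma ind_eq_indicator (p : Ω → Prop) : (fun ω => ind (p ω)) = ({ω | p ω} : Set Ω).indicator 1 := by
  ext ω
  by_cases h : p ω <;> simp [ind, h]

variable [MeasurableSpace Ω] {μ : Measure Ω} {p : Ω → Prop}

lemma integrable_ind [IsFiniteMeasure μ] (hp : MeasurableSet {ω | p ω}) : Integrable (fun ω => ind (p ω)) μ := by
  rw [ind_eq_indicator]
  exact (integrable_const (1 : ℝ)).indicator hp

lemma integral_ind (hp : MeasurableSet {ω | p ω}) : ∫ ω, ind (p ω) ∂μ = μ.real {ω | p ω} := by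
  rw [ind_eq_indicator, integral_indicator_one hp]

lemma sum_inv_sq_le (m : ℕ) : ∑ n ∈ Finset.range m, ((n : ℝ) ^ 2)⁻¹ ≤ 2 := by
  -- The telescoping bound is strengthened for the induction; the term `n = 0` is zero by the
  -- convention for inverses.
  suffices ∀ m : ℕ, ∑ n ∈ Finset.range (m + 2), ((n : ℝ) ^ 2)⁻¹ ≤ 2 - 1 / ((m : ℝ) + 1) by
    refine (Finset.sum_le_sum_of_subset_of_nonneg (Finset.range_mono (Nat.le_add_right m 2))
      fun n _ _ => by positivity).trans ((this m).trans ?_)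
    have : 0 ≤ 1 / ((m : ℝ) + 1) := by positivity
    linarith
  intro m
  induction m with
  | zero => norm_num [Finset.sum_range_succ]
  | succ m ih =>
    rw [Finset.sum_range_succ]
    push_cast
    have : (((m : ℝ) + 2) ^ 2)⁻¹ ≤ 1 / ((m : ℝ) + 1) - 1 / ((m : ℝ) + 1 + 1) := by
      rw [div_sub_div _ _ (by positivity) (by positivity), inv_eq_one_div,
        div_le_div_iff₀ (by positivity) (by positivity)]
      nlinarith [(Nat.cast_nonneg m : (0 : ℝ) ≤ m)]
    linarith

lemma inv_cube_le_inv_sq (n : ℕ) : ((n : ℝ) ^ 3)⁻¹ ≤ ((n : ℝ) ^ 2)⁻¹ := by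
  rcases Nat.eq_zero_or_pos n with rfl | hn
  · simp
  · have : (1 : ℝ) ≤ n := by exact_mod_cast hn
    gcongr
    norm_num

end Indicator

section Regime

variable {𝒳 Ω : Type*} [MeasurableSpace 𝒳] [MeasurableSpace Ω] {M : 𝒳 → Measure ℝ} {ν₁ ρ : ℝ}
  {P : Node → Set 𝒳} {l : 𝒳 → 𝒳 → ℝ} {ν₂ ε₀ L C d : ℝ} {μ : Measure Ω}
  {N : ℕ → Ω → Node} {X : ℕ → Ω → 𝒳} {Y : ℕ → Ω → ℝ}

lemma measurableSet_deviates {N : ℕ → Ω → Node} {Y F : ℕ → Ω → ℝ} {v : Node} (n : ℕ)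
    (hN : ∀ t, MeasurableSet {ω | v <:+ N t ω}) (hY : ∀ t, Measurable (Y t))
    (hF : ∀ t, Measurable (F t)) :
    MeasurableSet {ω | Deviates (fun t => N t ω) (fun t => Y t ω) (fun t => F t ω) n v} := by
  have hvis : Measurable fun ω => (visits (fun t => N t ω) n v : ℝ) := by
    simp only [visits, visitRounds, Finset.natCast_card_filter]
    exact Finset.measurable_fun_sum _ fun t _ =>
      Measurable.ite (hN t) measurable_const measurable_const
  have hsum : Measurable fun ω => ∑ t ∈ visitRounds (fun t => N t ω) n v, (Y t ω - F t ω) := by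
    simp only [visitRounds, Finset.sum_filter]
    exact Finset.measurable_fun_sum _ fun t _ =>
      Measurable.ite (hN t) ((hY t).sub (hF t)) measurable_const
  exact measurableSet_lt (hvis.const_mul _).sqrt hsum

namespace IsLocalHOORun

lemma measurableSet_suffix (h : IsLocalHOORun M ν₁ ρ P μ N X Y) (t : ℕ) (v : Node) :
    MeasurableSet {ω | v <:+ N t ω} :=
  h.past_le t _ (measurableSet_suffix_past N X Y t v)

lemma measurableSet_deviates_reward (hM : IsBanditEnvironment M)
    (h : IsLocalHOORun M ν₁ ρ P μ N X Y) (k n : ℕ) (v : Node) :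
    MeasurableSet {ω | Deviates (fun t => N (k + t) ω) (fun t => Y (k + t) ω)
      (fun t => meanPayoff M (X (k + t) ω)) n v} :=
  measurableSet_deviates n (fun t => h.measurableSet_suffix (k + t) v)
    (fun _ => h.measurable_reward _) fun _ => hM.measurable_meanPayoff.comp (h.measurable_arm _)

lemma measurableSet_pathDeviates (hM : IsBanditEnvironment M)
    (h : IsLocalHOORun M ν₁ ρ P μ N X Y) (k n z : ℕ) (o : ℕ → Node) :
    MeasurableSet {ω | PathDeviates z o (fun t => N (k + t) ω) (fun t => Y (k + t) ω)
      (fun t => meanPayoff M (X (k + t) ω)) n} := by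
  have : {ω | PathDeviates z o (fun t => N (k + t) ω) (fun t => Y (k + t) ω)
      (fun t => meanPayoff M (X (k + t) ω)) n} = ⋃ j ∈ Finset.Icc z (z + n),
      {ω | Deviates (fun t => N (k + t) ω) (fun t => meanPayoff M (X (k + t) ω))
        (fun t => Y (k + t) ω) n (o j)} := by
    ext ω
    simp [PathDeviates]
  rw [this]
  exact Finset.measurableSet_biUnion _ fun j _ =>
    measurableSet_deviates n (fun t => h.measurableSet_suffix (k + t) _)
      (fun _ => hM.measurable_meanPayoff.comp (h.measurable_arm _)) fun _ => h.measurable_reward _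

variable [IsProbabilityMeasure μ]

lemma integrable_regret (hM : IsBanditEnvironment M) (h : IsLocalHOORun M ν₁ ρ P μ N X Y) (t : ℕ) :
    Integrable (fun ω => bestPayoff M - meanPayoff M (X t ω)) μ :=
  (integrable_const _).sub (.of_mem_Icc 0 1
    (hM.measurable_meanPayoff.comp (h.measurable_arm t)).aemeasurable
    (.of_forall fun _ => hM.meanPayoff_mem _))

lemma integral_sum_deviates_le (hM : IsBanditEnvironment M) (h : IsLocalHOORun M ν₁ ρ P μ N X Y)
    (k m : ℕ) (v : Node) :
    ∫ ω, ∑ n ∈ Finset.range m, ind (Deviates (fun t => N (k + t) ω) (fun t => Y (k + t) ω)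
      (fun t => meanPayoff M (X (k + t) ω)) n v) ∂μ ≤ 2 := by
  rw [integral_finsetSum _ fun n _ => integrable_ind (h.measurableSet_deviates_reward hM k n v)]
  refine le_trans (Finset.sum_le_sum fun n _ => ?_) (sum_inv_sq_le m)
  rw [integral_ind (h.measurableSet_deviates_reward hM k n v)]
  exact (h.measureReal_deviates_le hM k n v).trans (inv_cube_le_inv_sq n)

lemma integral_sum_pathDeviates_le (hM : IsBanditEnvironment M)
    (h : IsLocalHOORun M ν₁ ρ P μ N X Y) (k m z : ℕ) (o : ℕ → Node) :
    ∫ ω, ∑ n ∈ Finset.range m, ind (PathDeviates z o (fun t => N (k + t) ω)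
      (fun t => Y (k + t) ω) (fun t => meanPayoff M (X (k + t) ω)) n) ∂μ ≤ 4 := by
  rw [integral_finsetSum _ fun n _ => integrable_ind (h.measurableSet_pathDeviates hM k n z o)]
  have h4 : (4 : ℝ) = 2 * 2 := by norm_num
  rw [h4]
  refine le_trans ?_ (mul_le_mul_of_nonneg_left (sum_inv_sq_le m) zero_le_two)
  rw [Finset.mul_sum]
  refine Finset.sum_le_sum fun n _ => ?_
  rw [integral_ind (h.measurableSet_pathDeviates hM k n z o)]
  have hsub : {ω | PathDeviates z o (fun t => N (k + t) ω) (fun t => Y (k + t) ω)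
      (fun t => meanPayoff M (X (k + t) ω)) n} ⊆ ⋃ j ∈ Finset.Icc z (z + n),
      {ω | Deviates (fun t => N (k + t) ω) (fun t => meanPayoff M (X (k + t) ω))
        (fun t => Y (k + t) ω) n (o j)} := by
    rintro ω ⟨j, hj, hdev⟩
    exact Set.mem_biUnion hj hdev
  refine (measureReal_mono hsub (measure_ne_top _ _)).trans
    ((measureReal_biUnion_finset_le _ _).trans ((Finset.sum_le_card_nsmul _ _ _
      fun j _ => h.measureReal_deviates_swap_le hM k n (o j)).trans ?_))
  rw [Nat.card_Icc, nsmul_eq_mul]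
  rcases Nat.eq_zero_or_pos n with rfl | hn
  · simp
  have hn' : (1 : ℝ) ≤ n := by exact_mod_cast hn
  -- The number of depths does not depend on `z`, so the bound is uniform over regimes; `(n + 1) /
  -- n³ ≤ 2 / n²`.
  have hc : z + n + 1 - z = n + 1 := by omega
  rw [hc, ← div_eq_mul_inv, ← div_eq_mul_inv, div_le_div_iff₀ (by positivity) (by positivity)]
  push_cast
  nlinarith [pow_pos (by linarith : (0 : ℝ) < n) 2]

/-- The expected regret of the regime `r`. -/
theorem integral_regime_regret_le (hP : IsTreeOfCoverings P) (hM : IsBanditEnvironment M)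
    (hν₁ : 0 < ν₁) (hρ0 : 0 < ρ) (hρ1 : ρ ≤ 1) (hL : 0 ≤ L)
    (hA1 : ShrinkingRegions ν₁ ρ P l ν₂) (hA2 : LocallyWeaklyLipschitz M l ε₀ L)
    (h : IsLocalHOORun M ν₁ ρ P μ N X Y) {r z m : ℕ} (hr : 1 ≤ r) (hz : Nat.clog 2 r = z)
    (hm : 2 ^ r = m) (hε : 4 * (ν₁ * ρ ^ z) ≤ ε₀) {k : ℕ} (hzk : z ≤ k) :
    ∫ ω, ∑ n ∈ Finset.range m, (bestPayoff M - meanPayoff M (X (m - 2 + (n + 1)) ω)) ∂μ ≤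
      4 + ∑ v ∈ unpromisingLevel M ν₁ ρ P z, (8 * Real.log m / (ν₁ * ρ ^ v.length) ^ 2 + 4) +
      ∑ h ∈ Finset.Ico z k, 4 * L * (ν₁ * ρ ^ h) *
        ∑ v ∈ fringe M ν₁ ρ P h, (8 * Real.log m / (ν₁ * ρ ^ v.length) ^ 2 + 4) +
      ∑ h ∈ Finset.Ico z k, 4 * L * (ν₁ * ρ ^ h) * (promisingLevel M ν₁ ρ P h).card +
      m * (4 * L * (ν₁ * ρ ^ k)) := by
  have : Nonempty 𝒳 := ⟨hA1.2.choose []⟩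
  obtain ⟨o, hlen, hchild, hopt⟩ := exists_optimal_path (M := M) hP
  set dev : Node → Ω → ℝ := fun v ω => ∑ n ∈ Finset.range m,
    ind (Deviates (fun t => N (m - 2 + t) ω) (fun t => Y (m - 2 + t) ω)
      (fun t => meanPayoff M (X (m - 2 + t) ω)) n v) with hdev
  set pdev : Ω → ℝ := fun ω => ∑ n ∈ Finset.range m,
    ind (PathDeviates z o (fun t => N (m - 2 + t) ω) (fun t => Y (m - 2 + t) ω)
      (fun t => meanPayoff M (X (m - 2 + t) ω)) n) with hpdev
  have hdevi : ∀ v, Integrable (dev v) μ := fun v => integrable_finsetSum _ fun n _ =>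
    integrable_ind (h.measurableSet_deviates_reward hM (m - 2) n v)
  have hpdevi : Integrable pdev μ := integrable_finsetSum _ fun n _ =>
    integrable_ind (h.measurableSet_pathDeviates hM (m - 2) n z o)
  have hdev2 : ∀ v, ∫ ω, dev v ω ∂μ ≤ 2 := fun v => h.integral_sum_deviates_le hM (m - 2) m v
  have hpdev4 : ∫ ω, pdev ω ∂μ ≤ 4 := h.integral_sum_pathDeviates_le hM (m - 2) m z o
  have hnode : ∀ᵐ ω ∂μ, ∀ n < m, CanPlay z ν₁ ρ (fun s => N (m - 2 + s) ω)
      (fun s => Y (m - 2 + s) ω) n (N (m - 2 + (n + 1)) ω) := by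
    rw [ae_all_iff]
    intro n
    by_cases hn : n < m
    · subst hm hz
      exact (h.node_selected r hr n hn).mono fun ω hω _ => hω
    · exact .of_forall fun _ h => (hn h).elim
  have harm : ∀ᵐ ω ∂μ, ∀ t, 1 ≤ t → X t ω ∈ P (N t ω) := by
    rw [ae_all_iff]
    intro t
    by_cases ht : 1 ≤ t
    · exact (h.arm_mem t ht).mono fun ω hω _ => hω
    · exact .of_forall fun _ h => (ht h).elim
  have hpath : ∀ᵐ ω ∂μ,
      ∑ n ∈ Finset.range m, (bestPayoff M - meanPayoff M (X (m - 2 + (n + 1)) ω)) ≤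
      pdev ω +
      ∑ v ∈ unpromisingLevel M ν₁ ρ P z,
        (8 * Real.log m / (ν₁ * ρ ^ v.length) ^ 2 + 2 + dev v ω) +
      ∑ h ∈ Finset.Ico z k, 4 * L * (ν₁ * ρ ^ h) *
        ∑ v ∈ fringe M ν₁ ρ P h, (8 * Real.log m / (ν₁ * ρ ^ v.length) ^ 2 + 2 + dev v ω) +
      ∑ h ∈ Finset.Ico z k, 4 * L * (ν₁ * ρ ^ h) * (promisingLevel M ν₁ ρ P h).card +
      m * (4 * L * (ν₁ * ρ ^ k)) := by
    filter_upwards [hnode, harm] with ω h1 h2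
    exact run_regret_le (H := fun s => N (m - 2 + s) ω) (Y := fun s => Y (m - 2 + s) ω)
      (x := fun s => X (m - 2 + s) ω) hP hM hν₁ hρ0 hρ1 hL h1 (fun t ht _ => h2 _ (by omega))
      hlen hchild hopt hε hA1 hA2 hzk
  have hvi : ∀ v : Node, Integrable (fun ω =>
      8 * Real.log m / (ν₁ * ρ ^ v.length) ^ 2 + 2 + dev v ω) μ := fun v =>
    (integrable_const _).add (hdevi v)
  have hsumi : ∀ S : Finset Node, Integrable (fun ω => ∑ v ∈ S,
      (8 * Real.log m / (ν₁ * ρ ^ v.length) ^ 2 + 2 + dev v ω)) μ := fun S =>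
    integrable_finsetSum _ fun v _ => hvi v
  have hsum : ∀ S : Finset Node, ∫ ω, ∑ v ∈ S,
      (8 * Real.log m / (ν₁ * ρ ^ v.length) ^ 2 + 2 + dev v ω) ∂μ ≤
      ∑ v ∈ S, (8 * Real.log m / (ν₁ * ρ ^ v.length) ^ 2 + 4) := fun S => by
    rw [integral_finsetSum _ fun v _ => hvi v]
    refine Finset.sum_le_sum fun v _ => ?_
    rw [integral_add (integrable_const _) (hdevi v), integral_const]
    simp only [probReal_univ, one_smul]
    linarith [hdev2 v]
  have hfri : ∀ h ∈ Finset.Ico z k, Integrable (fun ω => 4 * L * (ν₁ * ρ ^ h) *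
      ∑ v ∈ fringe M ν₁ ρ P h,
        (8 * Real.log m / (ν₁ * ρ ^ v.length) ^ 2 + 2 + dev v ω)) μ :=
    fun h _ => (hsumi _).const_mul _
  have i1 := hpdevi.add (hsumi (unpromisingLevel M ν₁ ρ P z))
  have i2 := i1.add (integrable_finsetSum _ hfri)
  refine (integral_mono_ae (integrable_finsetSum _ fun n _ => h.integrable_regret hM _)
    ((i2.add (integrable_const _)).add (integrable_const _)) hpath).trans ?_
  rw [integral_add' (i2.add (integrable_const _)) (integrable_const _),
    integral_add' i2 (integrable_const _), integral_add' i1 (integrable_finsetSum _ hfri),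
    integral_add' hpdevi (hsumi _), integral_const, integral_const]
  simp only [probReal_univ, one_smul]
  refine add_le_add (add_le_add (add_le_add (add_le_add hpdev4 (hsum _)) ?_) le_rfl) le_rfl
  rw [integral_finsetSum _ hfri]
  refine Finset.sum_le_sum fun h _ => ?_
  rw [integral_const_mul]
  exact mul_le_mul_of_nonneg_left (hsum _) (by positivity)

end IsLocalHOORun

end Regime

/-! ### Rates -/

section Rates

/-- The least depth satisfying the first bound works: its predecessor violates that bound, and the
second then loses only one factor `ρ ^ (-(d + 1))`. -/
lemma exists_depth {ρ d : ℝ} (hρ0 : 0 < ρ) (hρ1 : ρ < 1) (hd : 0 ≤ d) {m : ℝ} (hm : 1 ≤ m) :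
    ∃ k : ℕ, ρ ^ k ≤ m ^ (-(1 / (d + 2))) ∧
      (ρ ^ (-(d + 1))) ^ k ≤ ρ ^ (-(d + 1)) * m ^ ((d + 1) / (d + 2)) := by
  classical
  have hm0 : 0 < m := by linarith
  have hex : ∃ k : ℕ, ρ ^ k ≤ m ^ (-(1 / (d + 2))) :=
    (exists_pow_lt_of_lt_one (by positivity) hρ1).imp fun _ h => h.le
  have hb : 1 ≤ ρ ^ (-(d + 1)) :=
    Real.one_le_rpow_of_pos_of_le_one_of_nonpos hρ0 hρ1.le (by linarith)
  have hg : 1 ≤ m ^ ((d + 1) / (d + 2)) := Real.one_le_rpow hm (by positivity)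
  refine ⟨Nat.find hex, Nat.find_spec hex, ?_⟩
  rcases Nat.eq_zero_or_pos (Nat.find hex) with h0 | hpos
  · rw [h0, pow_zero]
    nlinarith
  · obtain ⟨j, hj⟩ : ∃ j, Nat.find hex = j + 1 := ⟨Nat.find hex - 1, by omega⟩
    have hlt := not_le.1 (Nat.find_min hex (m := j) (by omega))
    rw [hj, pow_succ, mul_comm]
    refine mul_le_mul_of_nonneg_left ?_ (by linarith)
    rw [Real.rpow_pow_comm hρ0.le]
    refine (Real.rpow_le_rpow_of_nonpos (by positivity) hlt.le (by linarith)).trans (le_of_eq ?_)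
    rw [← Real.rpow_mul hm0.le]
    congr 1
    field_simp

lemma sum_pow_Ico_le {b : ℝ} (hb : 1 < b) (z k : ℕ) :
    ∑ h ∈ Finset.Ico z (max z k), b ^ h ≤ b ^ k / (b - 1) := by
  have hsub : Finset.Ico z (max z k) ⊆ Finset.range k := by
    intro h hh
    rw [Finset.mem_Ico] at hh
    rw [Finset.mem_range]
    omega
  refine (Finset.sum_le_sum_of_subset_of_nonneg hsub fun _ _ _ => by positivity).trans ?_
  rw [geom_sum_eq hb.ne']
  have : 0 < b - 1 := by linarith
  gcongr
  linarith

lemma exists_poly_le_pow (Q : ℕ) {a : ℝ} (ha : 1 < a) :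
    ∃ K : ℝ, 0 ≤ K ∧ ∀ r : ℕ, (r : ℝ) ^ Q ≤ K * a ^ r := by
  obtain ⟨K, hK⟩ := (tendsto_pow_const_div_const_pow_of_one_lt Q ha).bddAbove_range
  have hle : ∀ r : ℕ, (r : ℝ) ^ Q / a ^ r ≤ K := fun r => hK ⟨r, rfl⟩
  refine ⟨K, le_trans (by positivity) (hle 0), fun r => ?_⟩
  exact (div_le_iff₀ (by positivity)).1 (hle r)

lemma two_pow_clog_le {r : ℕ} (hr : 1 ≤ r) : 2 ^ Nat.clog 2 r ≤ 2 * r := by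
  rcases hr.eq_or_lt with rfl | hr
  · simp
  · have h1 := Nat.pow_pred_clog_lt_self (by norm_num : 1 < 2) hr
    have h2 := Nat.clog_pos (by norm_num : 1 < 2) hr
    obtain ⟨j, hj⟩ : ∃ j, Nat.clog 2 r = j + 1 := ⟨Nat.clog 2 r - 1, by omega⟩
    rw [hj] at h1 ⊢
    rw [pow_succ]
    simp only [Nat.pred_eq_sub_one, Nat.add_sub_cancel] at h1
    omega

/-- The left side is `(2ρ⁻²)^z` with `2^z ≤ 2r`, hence at most polynomial in `r`. The logarithmic
growth of the starting depth is essential here. -/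
lemma exists_clog_pow_le {ρ a : ℝ} (hρ0 : 0 < ρ) (ha : 1 < a) :
    ∃ K : ℝ, 0 ≤ K ∧ ∀ r : ℕ, 1 ≤ r →
      (2 : ℝ) ^ Nat.clog 2 r * ((ρ ^ Nat.clog 2 r) ^ 2)⁻¹ ≤ K * a ^ r := by
  obtain ⟨Q, hQ⟩ := pow_unbounded_of_one_lt (2 * (ρ ^ 2)⁻¹) (one_lt_two (α := ℝ))
  obtain ⟨K, hK0, hK⟩ := exists_poly_le_pow Q ha
  refine ⟨2 ^ Q * K, by positivity, fun r hr => ?_⟩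
  have h1 : (2 : ℝ) ^ Nat.clog 2 r ≤ 2 * r := by exact_mod_cast two_pow_clog_le hr
  calc (2 : ℝ) ^ Nat.clog 2 r * ((ρ ^ Nat.clog 2 r) ^ 2)⁻¹
      = (2 * (ρ ^ 2)⁻¹) ^ Nat.clog 2 r := by
        rw [mul_pow, inv_pow, ← pow_mul, ← pow_mul, mul_comm 2]
    _ ≤ (2 ^ Q) ^ Nat.clog 2 r := by gcongr
    _ = (2 ^ Nat.clog 2 r) ^ Q := by rw [← pow_mul, ← pow_mul, mul_comm]
    _ ≤ (2 * r) ^ Q := by gcongr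
    _ = 2 ^ Q * (r : ℝ) ^ Q := mul_pow _ _ _
    _ ≤ 2 ^ Q * K * a ^ r := by
        rw [mul_assoc]
        exact mul_le_mul_of_nonneg_left (hK r) (by positivity)

lemma visit_bound_le {ν₁ q r x : ℝ} (hν₁ : 0 < ν₁) (hq0 : 0 < q) (hq1 : q ≤ 1) (hr : 1 ≤ r)
    (hx : x ≤ r) : 8 * x / (ν₁ * q) ^ 2 + 4 ≤ r * (8 / ν₁ ^ 2 + 4) * (q ^ 2)⁻¹ := by
  have h1 : 8 * x / (ν₁ * q) ^ 2 ≤ r * (8 / ν₁ ^ 2) * (q ^ 2)⁻¹ := by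
    have : r * (8 / ν₁ ^ 2) * (q ^ 2)⁻¹ = 8 * r / (ν₁ * q) ^ 2 := by field_simp
    rw [this]
    gcongr
  have h2 : 1 ≤ (q ^ 2)⁻¹ := (one_le_inv₀ (by positivity)).2 (pow_le_one₀ hq0.le hq1)
  nlinarith

lemma sum_Icc_regimes (g : ℕ → ℝ) (R : ℕ) : ∑ t ∈ Finset.Icc 1 (2 ^ (R + 1) - 2), g t =
    ∑ r ∈ Finset.Icc 1 R, ∑ n ∈ Finset.range (2 ^ r), g (2 ^ r - 2 + (n + 1)) := by
  induction R with
  | zero => simp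
  | succ R ih =>
    rw [Finset.sum_Icc_succ_top (by omega), ← ih]
    have h2 : 2 ≤ 2 ^ (R + 1) := by rw [pow_succ]; have := Nat.one_le_two_pow (n := R); omega
    generalize hA : 2 ^ (R + 1) = A at *
    have hB : 2 ^ (R + 1 + 1) - 2 = (A - 2) + A := by rw [pow_succ, hA]; omega
    rw [hB]
    generalize A - 2 = c
    clear hB h2 hA ih
    induction A with
    | zero => simp
    | succ A ihA =>
      rw [Finset.sum_range_succ, ← add_assoc c A 1, Finset.sum_Icc_succ_top (by omega), ihA]
      ring_nf

lemma sum_regime_bound_le {a γ K : ℝ} (ha : a = 2 ^ γ) (hγ : 0 < γ) (hγ1 : γ ≤ 1) (hK : 0 ≤ K)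
    {n : ℕ} (hn : 2 ≤ n) : ∑ r ∈ Finset.Icc 1 (Nat.log 2 (n + 1)), K * r * a ^ r ≤
      K * (4 * a / ((a - 1) * Real.log 2)) * Real.log n * (n : ℝ) ^ γ := by
  have ha1 : 1 < a := by rw [ha]; exact Real.one_lt_rpow one_lt_two hγ
  have ha0 : 0 < a := by linarith
  have ha' : 0 < a - 1 := by linarith
  set R := Nat.log 2 (n + 1)
  have hn0 : (0 : ℝ) < n := by positivity
  have hn2 : (2 : ℝ) ≤ n := by exact_mod_cast hn
  have hR : (2 : ℝ) ^ R ≤ n + 1 := by exact_mod_cast Nat.pow_log_le_self 2 (by omega)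
  have hl2 : 0 < Real.log 2 := Real.log_pos one_lt_two
  have hlogn : 0 < Real.log n := Real.log_pos (by linarith)
  -- This uses `n + 1 ≤ n²`, valid since `n ≥ 2`.
  have hRlog : (R : ℝ) ≤ 2 * Real.log n / Real.log 2 := by
    rw [le_div_iff₀ hl2, ← Real.log_pow, show (2 : ℝ) * Real.log n = Real.log ((n : ℝ) ^ 2) by
      rw [Real.log_pow]; norm_num]
    exact Real.log_le_log (by positivity) (by nlinarith)
  have haR : a ^ R ≤ 2 * (n : ℝ) ^ γ := by
    calc a ^ R = ((2 : ℝ) ^ R) ^ γ := by rw [ha, Real.rpow_pow_comm zero_le_two]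
      _ ≤ (2 * n) ^ γ := Real.rpow_le_rpow (by positivity) (by linarith) hγ.le
      _ = 2 ^ γ * (n : ℝ) ^ γ := Real.mul_rpow zero_le_two hn0.le
      _ ≤ 2 * (n : ℝ) ^ γ := by
        refine mul_le_mul_of_nonneg_right ?_ (by positivity)
        simpa using Real.rpow_le_rpow_of_exponent_le one_le_two hγ1
  have hgeom : ∑ r ∈ Finset.Icc 1 R, a ^ r ≤ a * a ^ R / (a - 1) := by
    have hsub : Finset.Icc 1 R ⊆ Finset.range (R + 1) := by
      intro r hr
      rw [Finset.mem_Icc] at hr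
      rw [Finset.mem_range]
      omega
    refine (Finset.sum_le_sum_of_subset_of_nonneg hsub fun _ _ _ => by positivity).trans ?_
    rw [geom_sum_eq ha1.ne', pow_succ']
    gcongr
    linarith
  -- Bounding `r` by `R` is the source of the logarithm; what remains is geometric, dominated by its
  -- last term.
  calc ∑ r ∈ Finset.Icc 1 R, K * r * a ^ r ≤ ∑ r ∈ Finset.Icc 1 R, K * R * a ^ r := by
        refine Finset.sum_le_sum fun r hr => ?_
        have : (r : ℝ) ≤ R := by exact_mod_cast (Finset.mem_Icc.1 hr).2
        gcongr
    _ = K * R * ∑ r ∈ Finset.Icc 1 R, a ^ r := by rw [Finset.mul_sum]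
    _ ≤ K * (2 * Real.log n / Real.log 2) * (a * (2 * (n : ℝ) ^ γ) / (a - 1)) := by
        refine mul_le_mul (mul_le_mul_of_nonneg_left hRlog hK) (hgeom.trans ?_)
          (Finset.sum_nonneg fun _ _ => by positivity) (by positivity)
        gcongr
    _ = _ := by field_simp; ring

end Rates

section Main

variable {𝒳 : Type*} [MeasurableSpace 𝒳] {M : 𝒳 → Measure ℝ} {ν₁ ρ : ℝ}
  {P : Node → Set 𝒳} {l : 𝒳 → 𝒳 → ℝ} {ν₂ ε₀ L C d : ℝ}

/-- The bound for the regret of one regime, for depths at which the local assumptions apply. -/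
lemma exists_regime_bound (hM : IsBanditEnvironment M) (hν₁ : 0 < ν₁) (hρ0 : 0 < ρ) (hρ1 : ρ < 1)
    (hl : IsDissimilarity l) (hν₂ : 0 < ν₂) (hL : 0 < L) (hC : 0 < C) (hd : 0 ≤ d)
    (hA1 : ShrinkingRegions ν₁ ρ P l ν₂) (hA2 : LocallyWeaklyLipschitz M l ε₀ L)
    (hA3 : NearOptimalPacking M l ε₀ (4 * L * ν₁ / ν₂) C d) :
    ∃ K : ℝ, 0 ≤ K ∧ ∀ r z m : ℕ, 1 ≤ r → Nat.clog 2 r = z → 2 ^ r = m →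
      4 * (ν₁ * ρ ^ z) ≤ ε₀ → ν₂ * ρ ^ z ≤ ε₀ → ∃ k, z ≤ k ∧
      4 + ∑ v ∈ unpromisingLevel M ν₁ ρ P z, (8 * Real.log m / (ν₁ * ρ ^ v.length) ^ 2 + 4) +
      ∑ h ∈ Finset.Ico z k, 4 * L * (ν₁ * ρ ^ h) *
        ∑ v ∈ fringe M ν₁ ρ P h, (8 * Real.log m / (ν₁ * ρ ^ v.length) ^ 2 + 4) +
      ∑ h ∈ Finset.Ico z k, 4 * L * (ν₁ * ρ ^ h) * (promisingLevel M ν₁ ρ P h).card +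
      m * (4 * L * (ν₁ * ρ ^ k)) ≤ K * r * (2 ^ ((d + 1) / (d + 2))) ^ r := by
  set a : ℝ := 2 ^ ((d + 1) / (d + 2)) with ha
  have ha1 : 1 < a := Real.one_lt_rpow one_lt_two (by positivity)
  obtain ⟨K₀, hK₀, hclog⟩ := exists_clog_pow_le (a := a) hρ0 ha1
  set b : ℝ := ρ ^ (-(d + 1)) with hb
  have hb1 : 1 < b := Real.one_lt_rpow_of_pos_of_lt_one_of_neg hρ0 hρ1 (by linarith)
  have hb' : 0 < b - 1 := by linarith
  set E : ℝ := 8 / ν₁ ^ 2 + 4 with hE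
  set C' : ℝ := C * ν₂ ^ (-d) with hC'
  set K₁ : ℝ := 8 * L * ν₁ * C' * E * (ρ ^ 2)⁻¹ + 4 * L * ν₁ * C' with hK₁
  refine ⟨4 + K₀ * E + K₁ * (b / (b - 1)) + 4 * L * ν₁, by positivity, ?_⟩
  intro r z m hr hz hm hε₁ hε₂
  have hr' : (1 : ℝ) ≤ r := by exact_mod_cast hr
  have hm' : (m : ℝ) = 2 ^ r := by rw [← hm]; push_cast; rfl
  have hm1 : (1 : ℝ) ≤ m := by rw [hm']; exact one_le_pow₀ one_le_two
  have hm0 : (0 : ℝ) < m := by linarith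
  have hlog : Real.log m ≤ r := by
    rw [hm', Real.log_pow]
    have := Real.log_two_lt_d9
    nlinarith
  have hma : (m : ℝ) ^ ((d + 1) / (d + 2)) = a ^ r := by
    rw [hm', ha, Real.rpow_pow_comm zero_le_two]
  have har : 1 ≤ a ^ r := one_le_pow₀ ha1.le
  obtain ⟨k, hk1, hk2⟩ := exists_depth hρ0 hρ1 hd hm1
  rw [hma] at hk2
  -- For small `m` the balancing depth may lie above `z`; the cut-off is then `z` and the
  -- intermediate range is empty.
  refine ⟨max z k, le_max_left _ _, ?_⟩
  have hq1 : ∀ h : ℕ, ρ ^ h ≤ 1 := fun h => pow_le_one₀ hρ0.le hρ1.le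
  have hvis : ∀ v : Node, 8 * Real.log m / (ν₁ * ρ ^ v.length) ^ 2 + 4 ≤
      r * E * ((ρ ^ v.length) ^ 2)⁻¹ := fun v =>
    visit_bound_le hν₁ (by positivity) (hq1 _) hr' hlog
  have hun : ∑ v ∈ unpromisingLevel M ν₁ ρ P z,
      (8 * Real.log m / (ν₁ * ρ ^ v.length) ^ 2 + 4) ≤ K₀ * E * r * a ^ r := by
    have hcard : ((unpromisingLevel M ν₁ ρ P z).card : ℝ) ≤ 2 ^ z := by
      exact_mod_cast (card_unpromisingLevel_le z)
    calc _ ≤ (unpromisingLevel M ν₁ ρ P z).card • (r * E * ((ρ ^ z) ^ 2)⁻¹) := by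
          refine Finset.sum_le_card_nsmul _ _ _ fun v hv => ?_
          rw [← (mem_unpromisingLevel.1 hv).1]
          exact hvis v
      _ ≤ 2 ^ z * (r * E * ((ρ ^ z) ^ 2)⁻¹) := by
          rw [nsmul_eq_mul]
          gcongr
      _ = E * r * (2 ^ z * ((ρ ^ z) ^ 2)⁻¹) := by ring
      _ ≤ E * r * (K₀ * a ^ r) := by
          have := hclog r hr
          rw [hz] at this
          gcongr
      _ = _ := by ring
  have hlevel : ∀ h ∈ Finset.Ico z (max z k),
      4 * L * (ν₁ * ρ ^ h) *
        ∑ v ∈ fringe M ν₁ ρ P h, (8 * Real.log m / (ν₁ * ρ ^ v.length) ^ 2 + 4) +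
      4 * L * (ν₁ * ρ ^ h) * (promisingLevel M ν₁ ρ P h).card ≤ K₁ * r * b ^ h := by
    intro h hh
    have hzh : z ≤ h := (Finset.mem_Ico.1 hh).1
    have hpow : ρ ^ h ≤ ρ ^ z := pow_le_pow_of_le_one hρ0.le hρ1.le hzh
    have hcard : ((promisingLevel M ν₁ ρ P h).card : ℝ) ≤ C' * (ρ ^ h) ^ (-d) := by
      refine (card_promising_le hM hl hν₁ hρ0 hν₂ hC.le hA1 hA2 hA3 (h := h) ?_ ?_
        fun v hv => mem_promisingLevel.1 hv).trans (le_of_eq ?_)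
      · refine le_trans ?_ hε₁
        gcongr
      · refine le_trans ?_ hε₂
        gcongr
      · rw [Real.mul_rpow hν₂.le (by positivity), hC', mul_assoc]
    have hfcard : ((fringe M ν₁ ρ P h).card : ℝ) ≤ 2 * (promisingLevel M ν₁ ρ P h).card := by
      exact_mod_cast (card_fringe_le h)
    -- A level costs the number `ρ^(-dh)` of nodes, times regret `ρ^h`, times visits `ρ^(-2h)`,
    -- which is `b ^ h`. Fringe nodes lie one level deeper, which costs the extra `ρ⁻²` in `K₁`.
    have hbh : b ^ h = (ρ ^ h) ^ (-d) * (ρ ^ h)⁻¹ := by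
      rw [hb, Real.rpow_pow_comm hρ0.le, ← Real.rpow_neg_one (ρ ^ h),
        ← Real.rpow_add (by positivity)]
      congr 1
      ring
    have hq0 : 0 < ρ ^ h := by positivity
    have hqh := hq1 h
    set q := ρ ^ h
    set s := q ^ (-d)
    have hs : 0 < s := by positivity
    have hfringe : ∑ v ∈ fringe M ν₁ ρ P h, (8 * Real.log m / (ν₁ * ρ ^ v.length) ^ 2 + 4) ≤
        2 * (C' * s) * (r * E * ((q * ρ) ^ 2)⁻¹) := by
      calc _ ≤ (fringe M ν₁ ρ P h).card • (r * E * ((q * ρ) ^ 2)⁻¹) := by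
            refine Finset.sum_le_card_nsmul _ _ _ fun v hv => ?_
            have := hvis v
            rwa [length_of_mem_fringe hv, pow_succ] at this ⊢
        _ ≤ _ := by
            rw [nsmul_eq_mul]
            refine mul_le_mul_of_nonneg_right ?_ (by positivity)
            linarith
    calc _ ≤ 4 * L * (ν₁ * q) * (2 * (C' * s) * (r * E * ((q * ρ) ^ 2)⁻¹)) +
          4 * L * (ν₁ * q) * (C' * s) := by gcongr
      _ ≤ 8 * L * ν₁ * C' * E * (ρ ^ 2)⁻¹ * r * (s * q⁻¹) +
          4 * L * ν₁ * C' * r * (s * q⁻¹) := by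
          refine add_le_add (le_of_eq ?_) ?_
          · field_simp
            ring
          · have h1 : q ≤ r * q⁻¹ := by
              have : 1 ≤ q⁻¹ := (one_le_inv₀ hq0).2 hqh
              nlinarith
            calc 4 * L * (ν₁ * q) * (C' * s) = 4 * L * ν₁ * C' * s * q := by ring
              _ ≤ 4 * L * ν₁ * C' * s * (r * q⁻¹) := by gcongr
              _ = _ := by ring
      _ = K₁ * r * b ^ h := by rw [hbh, hK₁]; ring
  have hmid := Finset.sum_le_sum hlevel
  rw [Finset.sum_add_distrib, ← Finset.mul_sum] at hmid
  have hgeom : K₁ * r * ∑ h ∈ Finset.Ico z (max z k), b ^ h ≤ K₁ * (b / (b - 1)) * r * a ^ r := by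
    calc _ ≤ K₁ * r * (b * a ^ r / (b - 1)) := by
          refine mul_le_mul_of_nonneg_left ((sum_pow_Ico_le hb1 z k).trans ?_) (by positivity)
          gcongr
      _ = _ := by ring
  have hlast : m * (4 * L * (ν₁ * ρ ^ max z k)) ≤ 4 * L * ν₁ * r * a ^ r := by
    have h1 : ρ ^ max z k ≤ (m : ℝ) ^ (-(1 / (d + 2))) :=
      (pow_le_pow_of_le_one hρ0.le hρ1.le (le_max_right z k)).trans hk1
    have h2 : (m : ℝ) * (m : ℝ) ^ (-(1 / (d + 2))) = a ^ r := by
      rw [← hma]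
      nth_rewrite 1 [← Real.rpow_one (m : ℝ)]
      rw [← Real.rpow_add hm0]
      congr 1
      field_simp
      ring
    calc _ = 4 * L * ν₁ * (m * ρ ^ max z k) := by ring
      _ ≤ 4 * L * ν₁ * (m * (m : ℝ) ^ (-(1 / (d + 2)))) := by gcongr
      _ = 4 * L * ν₁ * 1 * a ^ r := by rw [h2, mul_one]
      _ ≤ _ := by gcongr
  have hfour : (4 : ℝ) ≤ 4 * r * a ^ r := by nlinarith
  calc _ ≤ 4 * r * a ^ r + K₀ * E * r * a ^ r + K₁ * (b / (b - 1)) * r * a ^ r +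
        4 * L * ν₁ * r * a ^ r := by linarith
    _ = _ := by ring

end Main

end LocalHOO

end

theorem theorem4 {𝒳 : Type*} [MeasurableSpace 𝒳]
    (M : 𝒳 → MeasureTheory.Measure ℝ) (hM : LocalHOO.IsBanditEnvironment M)
    (ν₁ ρ : ℝ) (hν₁ : 0 < ν₁) (hρ0 : 0 < ρ) (hρ1 : ρ < 1)
    (P : LocalHOO.Node → Set 𝒳) (hP : LocalHOO.IsTreeOfCoverings P)
    (l : 𝒳 → 𝒳 → ℝ) (hl : LocalHOO.IsDissimilarity l)
    (ν₂ ε₀ L C d : ℝ) (hν₂ : 0 < ν₂) (hε₀ : 0 < ε₀) (hL : 0 < L) (hC : 0 < C) (hd : 0 ≤ d)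
    (hA1 : LocalHOO.ShrinkingRegions ν₁ ρ P l ν₂)
    (hA2 : LocalHOO.LocallyWeaklyLipschitz M l ε₀ L)
    (hA3 : LocalHOO.NearOptimalPacking M l ε₀ (4 * L * ν₁ / ν₂) C d) :
    ∃ K : ℝ, ∀ (Ω : Type*) [MeasurableSpace Ω] (μ : MeasureTheory.Measure Ω)
      [MeasureTheory.IsProbabilityMeasure μ]
      (N : ℕ → Ω → LocalHOO.Node) (X : ℕ → Ω → 𝒳) (Y : ℕ → Ω → ℝ),
      LocalHOO.IsLocalHOORun M ν₁ ρ P μ N X Y →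
      ∀ n : ℕ, 2 ≤ n →
        ∫ ω, LocalHOO.pseudoRegret M X n ω ∂μ ≤
          K * Real.log (n : ℝ) * (n : ℝ) ^ ((d + 1) / (d + 2)) := by
  obtain ⟨K, hK, hregime⟩ :=
    LocalHOO.exists_regime_bound hM hν₁ hρ0 hρ1 hl hν₂ hL hC hd hA1 hA2 hA3
  set γ : ℝ := (d + 1) / (d + 2) with hγ
  have hγ0 : 0 < γ := by positivity
  have hγ1 : γ ≤ 1 := by rw [hγ, div_le_one (by positivity)]; linarith
  set a : ℝ := 2 ^ γ with ha
  have ha1 : 1 < a := Real.one_lt_rpow one_lt_two hγ0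
  -- From depth `h₀` on both smallness conditions hold. Only the analysis sees `h₀`, and hence `ε₀`.
  obtain ⟨h₀, hh₀⟩ := exists_pow_lt_of_lt_one
    (div_pos hε₀ (by positivity : 0 < 4 * ν₁ + ν₂)) hρ1
  have hsmall : ∀ z, h₀ ≤ z → 4 * (ν₁ * ρ ^ z) ≤ ε₀ ∧ ν₂ * ρ ^ z ≤ ε₀ := by
    intro z hz
    have h1 : ρ ^ z < ε₀ / (4 * ν₁ + ν₂) :=
      (pow_le_pow_of_le_one hρ0.le hρ1.le hz).trans_lt hh₀
    rw [lt_div_iff₀ (by positivity)] at h1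
    have h2 : 0 < ρ ^ z * ν₁ := by positivity
    have h3 : 0 < ρ ^ z * ν₂ := by positivity
    constructor <;> linarith
  -- The second entry covers the regimes with `r ≤ 2 ^ h₀`, whose regret is at most their length `2
  -- ^ r`.
  set K' : ℝ := max K (2 ^ (2 ^ h₀)) with hK'
  refine ⟨K' * (4 * a / ((a - 1) * Real.log 2)), ?_⟩
  intro Ω _ μ _ N X Y h n hn
  set reg : ℕ → Ω → ℝ := fun t ω =>
    LocalHOO.bestPayoff M - LocalHOO.meanPayoff M (X t ω) with hreg
  have hint : ∀ t, MeasureTheory.Integrable (reg t) μ := fun t => h.integrable_regret hM t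
  have hnonneg : ∀ t ω, 0 ≤ reg t ω := fun t ω => sub_nonneg.2 (hM.le_bestPayoff _)
  have hone : ∀ t ω, reg t ω ≤ 1 := fun t ω => by
    have h1 := hM.bestPayoff_le_one
    have h2 := (hM.meanPayoff_mem (X t ω)).1
    simp only [hreg]
    linarith
  have hbound : ∀ r : ℕ, 1 ≤ r →
      ∑ j ∈ Finset.range (2 ^ r), ∫ ω, reg (2 ^ r - 2 + (j + 1)) ω ∂μ ≤ K' * r * a ^ r := by
    intro r hr
    have hr' : (1 : ℝ) ≤ r := by exact_mod_cast hr
    have har : 1 ≤ a ^ r := one_le_pow₀ ha1.le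
    by_cases hz : h₀ ≤ Nat.clog 2 r
    · obtain ⟨hs1, hs2⟩ := hsmall _ hz
      obtain ⟨k, hzk, hk⟩ := hregime r _ _ hr rfl rfl hs1 hs2
      rw [← MeasureTheory.integral_finsetSum _ fun j _ => hint _]
      refine (h.integral_regime_regret_le hP hM hν₁ hρ0 hρ1.le hL.le hA1 hA2 hr rfl rfl hs1
        hzk).trans (hk.trans ?_)
      gcongr
      exact le_max_left _ _
    · have hr2 : r ≤ 2 ^ h₀ := by
        refine (Nat.le_pow_clog (by norm_num : 1 < 2) r).trans ?_
        exact Nat.pow_le_pow_right (by norm_num) (by omega)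
      have h1 : ∑ j ∈ Finset.range (2 ^ r), ∫ ω, reg (2 ^ r - 2 + (j + 1)) ω ∂μ ≤ 2 ^ r := by
        refine (Finset.sum_le_card_nsmul _ _ 1 fun j _ => ?_).trans (by simp)
        refine (MeasureTheory.integral_mono (hint _) (MeasureTheory.integrable_const 1)
          fun ω => hone _ ω).trans (by simp)
      have h2 : (2 : ℝ) ^ r ≤ K' :=
        (pow_le_pow_right₀ one_le_two hr2).trans (le_max_right _ _)
      have hK'0 : 0 ≤ K' := hK.trans (le_max_left _ _)
      calc _ ≤ K' * 1 * 1 := by linarith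
        _ ≤ K' * r * a ^ r := by gcongr
  -- Round `n` belongs to regime `log₂ (n + 1)`, rounded down. Completing that regime only increases
  -- the bound, since the regret of each round is nonnegative.
  have hn2 : n ≤ 2 ^ (Nat.log 2 (n + 1) + 1) - 2 := by
    have := Nat.lt_pow_succ_log_self (by norm_num : 1 < 2) (n + 1)
    rw [Nat.succ_eq_add_one] at this
    omega
  calc ∫ ω, LocalHOO.pseudoRegret M X n ω ∂μ
      = ∫ ω, ∑ t ∈ Finset.Icc 1 n, reg t ω ∂μ := by
        congr 1
        ext ω
        simp [LocalHOO.pseudoRegret, hreg, Finset.sum_sub_distrib]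
    _ = ∑ t ∈ Finset.Icc 1 n, ∫ ω, reg t ω ∂μ :=
        MeasureTheory.integral_finsetSum _ fun t _ => hint t
    _ ≤ ∑ t ∈ Finset.Icc 1 (2 ^ (Nat.log 2 (n + 1) + 1) - 2), ∫ ω, reg t ω ∂μ :=
        Finset.sum_le_sum_of_subset_of_nonneg (Finset.Icc_subset_Icc_right hn2)
          fun t _ _ => MeasureTheory.integral_nonneg (hnonneg t)
    _ = ∑ r ∈ Finset.Icc 1 (Nat.log 2 (n + 1)),
          ∑ j ∈ Finset.range (2 ^ r), ∫ ω, reg (2 ^ r - 2 + (j + 1)) ω ∂μ :=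
        LocalHOO.sum_Icc_regimes _ _
    _ ≤ ∑ r ∈ Finset.Icc 1 (Nat.log 2 (n + 1)), K' * r * a ^ r :=
        Finset.sum_le_sum fun r hr => hbound r (Finset.mem_Icc.1 hr).1
    _ ≤ _ := LocalHOO.sum_regime_bound_le ha hγ0 hγ1 (hK.trans (le_max_left _ _)) hn
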